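/- Let $n,r\ge 0$ be integers, let $K$ be a field, and let $t\in K$, $t\neq 0$; if $r>n$, assume also that $t^k\neq -1$ for $0\le k\le r-n-1$. (For example, $t$ may be a positive real number in $K=\mathbb{R}$, or an indeterminate in $K=\mathbb{Q}(t)$.) Let $x=(x_1,\dots,x_n)$ and $u=(u_1,\dots,u_r)$ be independent indeterminates over $K$. For $1\le i\le n$ let $T_i$ be the $K$-algebra endomorphism of the field $K(x,u)$ which sends $x_i$ to $1/x_i$ and fixes all the other indeterminates, and put $\mathcal{T}=(1+T_1)\cdots(1+T_n)$. Let $$\Phi_\pi=\prod_{i=1}^n\frac{1-tx_i^2}{1-x_i^2}\prod_{1\le i<j\le n}\frac{1-tx_ix_j}{1-x_ix_j},\qquad R(w)=\prod_{i=1}^n\frac{1-twx_i}{1-wx_i}\,\frac{1-tw/x_i}{1-w/x_i},$$ and let $(-t;t)_{n-r}$ be the shifted factorial, equal to $\prod_{k=1}^{n-r}(1+t^k)$ if $n\ge r$ and to $\prod_{k=0}^{r-n-1}(1+t^{-k})^{-1}$ if $n<r$. Then, in $K(x,u)$, $$\mathcal{T}\left(\Phi_\pi\prod_{k=1}^r\prod_{i=1}^n\frac{1-tu_k/x_i}{1-u_k/x_i}\right)=(-t;t)_{n-r}\sum_{I\subset\{1,\dots,r\}}c_I\prod_{i\in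 I}R(u_i),$$ where $$c_I=t^{n(r-|I|)}\prod_{1\le i<j\le r}\frac{1-v_iv_j}{1-tv_iv_j},\qquad v_i=\begin{cases}u_i & (i\in I),\\ 1/(tu_i) & (i\notin I).\end{cases}$$ -/

import Mathlib

noncomputable section

namespace RationalIdentity

open MvPolynomial

/-- The field `K(x₁, …, xₙ, u₁, …, uᵣ)` of rational functions in `n + r` independent
indeterminates over `K`. -/
abbrev RatField (K : Type*) [Field K] (n r : ℕ) : Type _ :=
  FractionRing (MvPolynomial (Fin n ⊕ Fin r) K)

section

variable {K : Type*} [Field K] {n r : ℕ}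

/-- The indeterminate `xᵢ`. -/
def x (i : Fin n) : RatField K n r :=
  algebraMap (MvPolynomial (Fin n ⊕ Fin r) K) _ (X (Sum.inl i))

/-- The indeterminate `uₖ`. -/
def u (k : Fin r) : RatField K n r :=
  algebraMap (MvPolynomial (Fin n ⊕ Fin r) K) _ (X (Sum.inr k))

/-- The images of the indeterminates under the substitution `xᵢ ↦ 1 / xᵢ`; all the other
indeterminates are fixed. -/
def invVar (i : Fin n) : Fin n ⊕ Fin r → RatField K n r
  | Sum.inl j => if j = i then (x j)⁻¹ else x j
  | Sum.inr k => u k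

theorem aeval_invVar_injective (i : Fin n) :
    Function.Injective (aeval (R := K) (invVar (K := K) (n := n) (r := r) i)) := by
  set g : Fin n ⊕ Fin r → RatField K n r := invVar i with hg
  set A := Algebra.adjoin K (Set.range g) with hA
  have hmem : ∀ s, IsAlgebraic A (g s) := fun s =>
    isAlgebraic_algebraMap (⟨g s, Algebra.subset_adjoin ⟨s, rfl⟩⟩ : A)
  have hX : ∀ s, IsAlgebraic A
      (algebraMap (MvPolynomial (Fin n ⊕ Fin r) K) (RatField K n r) (X s)) := by
    rintro (j | k)
    · by_cases h : j = i
      · have h1 := hmem (Sum.inl j)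
        simp only [hg, invVar, h, if_true] at h1
        rw [h]
        exact IsAlgebraic.inv_iff.mp h1
      · have h1 := hmem (Sum.inl j)
        simp only [hg, invVar, h, if_false] at h1
        exact h1
    · exact hmem (Sum.inr k)
  have hP : ∀ p : MvPolynomial (Fin n ⊕ Fin r) K, IsAlgebraic A
      (algebraMap (MvPolynomial (Fin n ⊕ Fin r) K) (RatField K n r) p) := by
    intro p
    induction p using MvPolynomial.induction_on with
    | C a =>
      have : algebraMap (MvPolynomial (Fin n ⊕ Fin r) K) (RatField K n r) (C a)
          = algebraMap A (RatField K n r) (algebraMap K A a) := by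
        rw [← IsScalarTower.algebraMap_apply K A, ← MvPolynomial.algebraMap_eq,
          ← IsScalarTower.algebraMap_apply K (MvPolynomial (Fin n ⊕ Fin r) K)]
      rw [this]
      exact isAlgebraic_algebraMap _
    | add p q hp hq => rw [map_add]; exact hp.add hq
    | mul_X p s hp => rw [map_mul]; exact hp.mul (hX s)
  have : Algebra.IsAlgebraic A (RatField K n r) := ⟨fun z => by
    obtain ⟨a, b, -, rfl⟩ := IsFractionRing.div_surjective (A := MvPolynomial (Fin n ⊕ Fin r) K) z
    rw [div_eq_mul_inv]
    exact (hP a).mul (IsAlgebraic.inv_iff.mpr (hP b))⟩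
  have hle : Cardinal.lift (Cardinal.mk (Fin n ⊕ Fin r)) ≤
      Cardinal.lift (Algebra.trdeg K (RatField K n r)) := by
    have hind : AlgebraicIndependent K
        (fun s : Fin n ⊕ Fin r =>
          algebraMap (MvPolynomial (Fin n ⊕ Fin r) K) (RatField K n r) (X s)) :=
      (MvPolynomial.algebraicIndependent_X (Fin n ⊕ Fin r) K).map'
        (f := IsScalarTower.toAlgHom K _ (RatField K n r))
        (IsFractionRing.injective (MvPolynomial (Fin n ⊕ Fin r) K) (RatField K n r))
    exact hind.lift_cardinalMk_le_trdeg
  exact (Algebra.IsAlgebraic.isTranscendenceBasis_of_lift_le_trdeg_of_finite K g hle).1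

/-- The operator `Tᵢ : xᵢ ↦ 1 / xᵢ`, that is, the `K`-algebra endomorphism of the field of
rational functions that sends `xᵢ` to `1 / xᵢ` and fixes all the other indeterminates. -/
def T (i : Fin n) : RatField K n r →ₐ[K] RatField K n r :=
  IsFractionRing.liftAlgHom (g := aeval (invVar i)) (aeval_invVar_injective i)

@[simp] theorem T_x (i j : Fin n) :
    T i (x j : RatField K n r) = if j = i then (x j)⁻¹ else x j := by
  rw [T, x, IsFractionRing.liftAlgHom_apply, IsFractionRing.lift_algebraMap]
  exact aeval_X _ _

@[simp] theorem T_u (i : Fin n) (k : Fin r) : T i (u k : RatField K n r) = u k := by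
  rw [T, u, IsFractionRing.liftAlgHom_apply, IsFractionRing.lift_algebraMap]
  exact aeval_X _ _

/-- The symmetrizer `𝒯 = (1 + T₁) ⋯ (1 + Tₙ)`. -/
def symmetrizer (K : Type*) [Field K] (n r : ℕ) : Module.End K (RatField K n r) :=
  (List.ofFn fun i : Fin n => (1 + (T i).toLinearMap : Module.End K (RatField K n r))).prod

end

section

variable {L : Type*} [Field L]

/-- The `q`-shifted factorial `(a; q)_k` for an integer `k`: it is `∏_{0 ≤ j < k} (1 - a qʲ)` for
`k ≥ 0`, and `(a; q)_{-m} = ∏_{1 ≤ j ≤ m} (1 - a q⁻ʲ)⁻¹`. -/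
def qPochhammer (a q : L) : ℤ → L
  | Int.ofNat k => ∏ j ∈ Finset.range k, (1 - a * q ^ j)
  | Int.negSucc m => ∏ j ∈ Finset.range (m + 1), (1 - a / q ^ (j + 1))⁻¹

/-- `Φ_π = ∏ᵢ (1 - t xᵢ²) / (1 - xᵢ²) ∏_{i < j} (1 - t xᵢ xⱼ) / (1 - xᵢ xⱼ)`. -/
def Phi {n : ℕ} (t : L) (x : Fin n → L) : L :=
  (∏ i, (1 - t * x i ^ 2) / (1 - x i ^ 2)) *
    ∏ i, ∏ j ∈ Finset.Ioi i, (1 - t * x i * x j) / (1 - x i * x j)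

/-- `R(w) = ∏ᵢ (1 - t w xᵢ) / (1 - w xᵢ) · (1 - t w / xᵢ) / (1 - w / xᵢ)`. -/
def R {n : ℕ} (t : L) (x : Fin n → L) (w : L) : L :=
  ∏ i, ((1 - t * w * x i) / (1 - w * x i)) * ((1 - t * w / x i) / (1 - w / x i))

/-- `vᵢ = uᵢ` if `i ∈ I` and `vᵢ = 1 / (t uᵢ)` if `i ∉ I`. -/
def v {r : ℕ} (t : L) (u : Fin r → L) (I : Finset (Fin r)) (i : Fin r) : L :=
  if i ∈ I then u i else 1 / (t * u i)

/-- `c_I = t^{n (r - |I|)} ∏_{i < j} (1 - vᵢ vⱼ) / (1 - t vᵢ vⱼ)`. -/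
def c {r : ℕ} (n : ℕ) (t : L) (u : Fin r → L) (I : Finset (Fin r)) : L :=
  t ^ (n * (r - I.card)) *
    ∏ i, ∏ j ∈ Finset.Ioi i, (1 - v t u I i * v t u I j) / (1 - t * v t u I i * v t u I j)

end

end RationalIdentity

end

/-! Both sides are treated as functions of one more parameter `w`, which plays the role of a new
`u_b`: `xFun` on the symmetrized side, `uFun` on the subset side. Each is a rational function of `w`
with no pole at infinity and only simple poles, among the `x_a^±1`, the `u_j` and the `1 / (t u_j)`.

At `y = x_a^±1` the residues of `xFun` and `uFun` are one common factor times the same two sums with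
`x_a` removed (`hasRes_xFun`, `hasRes_uFun`), so they are proportional by induction, with ratio `q =
(-t; t)_{|s|-|k|-1}`. At the remaining points `xFun` is regular (`hasRes_xFun_flipU`), while in
`uFun` the subsets with and without `b` have opposite residues (`hasRes_pair`). Hence `xFun - q *
uFun` is constant (`xFun_sub_uFun_eq`).

At `w = 0` the new parameter disappears: `xFun` becomes `xSum`, and `uFun` becomes `(1 +
t^(|s|-|k|)) * uSum`. That scalar is the ratio of consecutive shifted factorials, so the constant is
zero by induction on the number of `u`'s (`xSum_uWeight_eq`). The case without `u`'s (`xSum_one`)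
uses the same constancy, evaluated at `w = 1 / (t x_a)`.

All this works for `Generic` elements of an infinite field; indeterminates are generic, and the
symmetrizer expands into a sum over the sets of inverted variables. -/

namespace SignSum

open Polynomial Filter

/-! ### Rational functions of one variable: regularity, simple poles, a Liouville-type argument. -/

section Regular

variable {L : Type*} [Field L]

/-- `f` is a rational function defined at `p`, up to finitely many values away from `p`. -/
def Reg (p : L) (f : L → L) : Prop :=
  ∃ A B : L[X], B.eval p ≠ 0 ∧ f p * B.eval p = A.eval p ∧
    ∀ᶠ w in cofinite, f w * B.eval w = A.eval w

theorem one_sub_div_ne_zero {p w : L} (hp : p ≠ 0) (hw : w ≠ p) : 1 - w / p ≠ 0 := by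
  rw [sub_ne_zero, Ne, eq_comm, div_eq_one_iff_eq hp]
  exact hw

theorem eventually_eval_ne_zero {A : L[X]} (hA : A ≠ 0) : ∀ᶠ w in cofinite, A.eval w ≠ 0 := by
  classical
  have : {w | ¬ A.eval w ≠ 0}.Finite := by
    refine A.roots.toFinset.finite_toSet.subset fun w hw => ?_
    simpa [hA] using hw
  exact this

namespace Reg

variable {p : L} {f g : L → L}

theorem polynomial (A : L[X]) : Reg p fun w => A.eval w :=
  ⟨A, 1, by simp, by simp, by simp⟩

theorem const (a : L) : Reg p fun _ => a := by
  simpa using polynomial (p := p) (C a)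

theorem id : Reg p fun w => w := by
  simpa using polynomial (p := p) X

theorem add (hf : Reg p f) (hg : Reg p g) : Reg p fun w => f w + g w := by
  obtain ⟨A, B, h1, h2, h3⟩ := hf
  obtain ⟨A', B', h1', h2', h3'⟩ := hg
  refine ⟨A * B' + A' * B, B * B', by simp [h1, h1'], ?_, ?_⟩
  · simp only [eval_mul, eval_add, ← h2, ← h2']; ring
  · filter_upwards [h3, h3'] with w h h'
    simp only [eval_mul, eval_add, ← h, ← h']; ring

theorem mul (hf : Reg p f) (hg : Reg p g) : Reg p fun w => f w * g w := by
  obtain ⟨A, B, h1, h2, h3⟩ := hf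
  obtain ⟨A', B', h1', h2', h3'⟩ := hg
  refine ⟨A * A', B * B', by simp [h1, h1'], ?_, ?_⟩
  · simp only [eval_mul, ← h2, ← h2']; ring
  · filter_upwards [h3, h3'] with w h h'
    simp only [eval_mul, ← h, ← h']; ring

theorem sub (hf : Reg p f) (hg : Reg p g) : Reg p fun w => f w - g w := by
  have := hf.add ((const (-1)).mul hg)
  simpa [sub_eq_add_neg] using this

theorem inv (hf : Reg p f) (hp : f p ≠ 0) : Reg p fun w => (f w)⁻¹ := by
  obtain ⟨A, B, h1, h2, h3⟩ := hf
  have hA : A.eval p ≠ 0 := h2 ▸ mul_ne_zero hp h1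
  have hA0 : A ≠ 0 := by rintro rfl; simp at hA
  refine ⟨B, A, hA, by rw [← h2]; field_simp, ?_⟩
  filter_upwards [h3, eventually_eval_ne_zero hA0] with w h h'
  have : f w ≠ 0 := by intro h0; rw [h0, zero_mul] at h; exact h' h.symm
  rw [← h]; field_simp

theorem div (hf : Reg p f) (hg : Reg p g) (hp : g p ≠ 0) : Reg p fun w => f w / g w := by
  simpa [div_eq_mul_inv] using hf.mul (hg.inv hp)

theorem prod {ι : Type*} (s : Finset ι) {f : ι → L → L} (h : ∀ i ∈ s, Reg p (f i)) :
    Reg p fun w => ∏ i ∈ s, f i w := by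
  classical
  induction s using Finset.induction_on with
  | empty => simpa using const 1
  | insert a s ha ih =>
    simp only [Finset.prod_insert ha]
    exact (h a (by simp)).mul (ih fun i hi => h i (by simp [hi]))

theorem sum {ι : Type*} (s : Finset ι) {f : ι → L → L} (h : ∀ i ∈ s, Reg p (f i)) :
    Reg p fun w => ∑ i ∈ s, f i w := by
  classical
  induction s using Finset.induction_on with
  | empty => simpa using const 0
  | insert a s ha ih =>
    simp only [Finset.sum_insert ha]
    exact (h a (by simp)).add (ih fun i hi => h i (by simp [hi]))

/-- An algebraic substitute for continuity: the numerator of the difference has infinitely many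
roots, so it is zero, and the representation is also valid at `p` itself. -/
theorem eq_of_eventually_eq [Infinite L] (hf : Reg p f) (hg : Reg p g)
    (h : ∀ᶠ w in cofinite, f w = g w) : f p = g p := by
  obtain ⟨A, B, h1, h2, h3⟩ := hf.sub hg
  have hA : A = 0 := by
    by_contra hA
    have : ∀ᶠ _ in (cofinite : Filter L), False := by
      filter_upwards [h, h3, eventually_eval_ne_zero hA] with w a b c
      rw [a, sub_self, zero_mul] at b
      exact c b.symm
    exact (cofinite_neBot (α := L)).ne (Filter.eventually_false_iff_eq_bot.1 this)
  rw [hA, eval_zero] at h2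
  exact sub_eq_zero.1 ((mul_eq_zero.1 h2).resolve_right h1)

end Reg

/-- `f` has at most a simple pole at `p`, and `(1 - w / p) f(w)` takes the value `a` there. -/
def HasRes (p : L) (f : L → L) (a : L) : Prop :=
  ∃ h : L → L, Reg p h ∧ h p = a ∧ ∀ᶠ w in cofinite, (1 - w / p) * f w = h w

namespace HasRes

variable {p : L} {f g : L → L} {a b : L}

theorem of_reg (hp : p ≠ 0) (hf : Reg p f) : HasRes p f 0 :=
  ⟨fun w => (1 - w / p) * f w, ((Reg.const 1).sub (Reg.id.div (Reg.const p) hp)).mul hf,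
    by simp [hp], by simp⟩

theorem add (hf : HasRes p f a) (hg : HasRes p g b) : HasRes p (fun w => f w + g w) (a + b) := by
  obtain ⟨h, h1, rfl, h3⟩ := hf
  obtain ⟨h', h1', rfl, h3'⟩ := hg
  refine ⟨_, h1.add h1', rfl, ?_⟩
  filter_upwards [h3, h3'] with w a b
  rw [← a, ← b]; ring

theorem mul_reg (hf : HasRes p f a) (hg : Reg p g) : HasRes p (fun w => g w * f w) (g p * a) := by
  obtain ⟨h, h1, rfl, h3⟩ := hf
  refine ⟨_, hg.mul h1, rfl, ?_⟩
  filter_upwards [h3] with w a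
  rw [← a]; ring

theorem sum {ι : Type*} (s : Finset ι) {f : ι → L → L} {a : ι → L}
    (h : ∀ i ∈ s, HasRes p (f i) (a i)) (hp : p ≠ 0) :
    HasRes p (fun w => ∑ i ∈ s, f i w) (∑ i ∈ s, a i) := by
  classical
  induction s using Finset.induction_on with
  | empty => simpa using of_reg hp (Reg.const 0)
  | insert a s ha ih =>
    simp only [Finset.sum_insert ha]
    exact (h a (by simp)).add (ih fun i hi => h i (by simp [hi]))

theorem pole (hp : p ≠ 0) (hg : Reg p g) : HasRes p (fun w => g w / (1 - w / p)) (g p) := by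
  refine ⟨g, hg, rfl, ?_⟩
  have : ∀ᶠ w in cofinite, w ≠ p := by
    have : {w | ¬ w ≠ p}.Finite := by simp
    exact this
  filter_upwards [this] with w hw
  have : 1 - w / p ≠ 0 := one_sub_div_ne_zero hp hw
  field_simp

end HasRes

/-- `f` is, away from `S`, a rational function without pole at infinity whose poles are simple
and lie in `S`. -/
def SimpleRat (S : Finset L) (f : L → L) : Prop :=
  ∃ N : L[X], N.natDegree ≤ S.card ∧ ∀ w ∉ S, f w * ∏ p ∈ S, (1 - w / p) = N.eval w

theorem natDegree_prod_poles_le (S : Finset L) :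
    (∏ p ∈ S, (1 - C p⁻¹ * X : L[X])).natDegree ≤ S.card := by
  refine (natDegree_prod_le _ _).trans ?_
  rw [Finset.card_eq_sum_ones]
  refine Finset.sum_le_sum fun p _ => ?_
  compute_degree

theorem eval_prod_poles (S : Finset L) (w : L) :
    (∏ p ∈ S, (1 - C p⁻¹ * X : L[X])).eval w = ∏ p ∈ S, (1 - w / p) := by
  rw [eval_prod]
  refine Finset.prod_congr rfl fun p _ => ?_
  simp [div_eq_inv_mul]

namespace SimpleRat

variable {S S' : Finset L} {f g : L → L}

theorem const (a : L) : SimpleRat ∅ fun _ : L => a :=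
  ⟨C a, by simp, by simp⟩

theorem factor {p : L} (hp : p ≠ 0) (a b : L) :
    SimpleRat {p} fun w => (a + b * w) / (1 - w / p) := by
  refine ⟨C a + C b * X, by simpa using by compute_degree, fun w hw => ?_⟩
  have hw : w ≠ p := by simpa using hw
  have : 1 - w / p ≠ 0 := one_sub_div_ne_zero hp hw
  simp only [Finset.prod_singleton, eval_add, eval_mul, eval_C, eval_X]
  field_simp

theorem add (hf : SimpleRat S f) (hg : SimpleRat S g) : SimpleRat S fun w => f w + g w := by
  obtain ⟨N, h1, h2⟩ := hf
  obtain ⟨N', h1', h2'⟩ := hg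
  refine ⟨N + N', natDegree_add_le_of_degree_le h1 h1', fun w hw => ?_⟩
  rw [eval_add, ← h2 w hw, ← h2' w hw]; ring

theorem const_mul (a : L) (hf : SimpleRat S f) : SimpleRat S fun w => a * f w := by
  obtain ⟨N, h1, h2⟩ := hf
  refine ⟨C a * N, (natDegree_C_mul_le _ _).trans h1, fun w hw => ?_⟩
  rw [eval_mul, eval_C, ← h2 w hw]; ring

theorem sum {ι : Type*} (s : Finset ι) {f : ι → L → L} (h : ∀ i ∈ s, SimpleRat S (f i)) :
    SimpleRat S fun w => ∑ i ∈ s, f i w := by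
  classical
  induction s using Finset.induction_on with
  | empty => exact ⟨0, by simp, by simp⟩
  | insert a s ha ih =>
    simp only [Finset.sum_insert ha]
    exact (h a (by simp)).add (ih fun i hi => h i (by simp [hi]))

variable [DecidableEq L]

theorem mul (hf : SimpleRat S f) (hg : SimpleRat S' g) (h : Disjoint S S') :
    SimpleRat (S ∪ S') fun w => f w * g w := by
  obtain ⟨N, h1, h2⟩ := hf
  obtain ⟨N', h1', h2'⟩ := hg
  refine ⟨N * N', ?_, fun w hw => ?_⟩
  · rw [Finset.card_union_of_disjoint h]
    exact natDegree_mul_le.trans (add_le_add h1 h1')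
  · rw [Finset.mem_union, not_or] at hw
    rw [Finset.prod_union h, eval_mul, ← h2 w hw.1, ← h2' w hw.2]; ring

theorem mono (hf : SimpleRat S f) (h : S ⊆ S') : SimpleRat S' f := by
  have h1 : SimpleRat (S' \ S) fun _ : L => (1 : L) :=
    ⟨∏ p ∈ S' \ S, (1 - C p⁻¹ * X), natDegree_prod_poles_le _,
      fun w _ => by rw [eval_prod_poles, one_mul]⟩
  have := hf.mul h1 Finset.disjoint_sdiff
  rw [Finset.union_sdiff_of_subset h] at this
  simpa using this

theorem prod {ι : Type*} (s : Finset ι) {P : ι → L} {f : ι → L → L}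
    (hP : Set.InjOn P s) (h : ∀ i ∈ s, SimpleRat {P i} (f i)) :
    SimpleRat (s.image P) fun w => ∏ i ∈ s, f i w := by
  classical
  induction s using Finset.induction_on with
  | empty => simpa using const 1
  | insert a s ha ih =>
    simp only [Finset.prod_insert ha, Finset.image_insert]
    rw [Finset.insert_eq]
    refine (h a (by simp)).mul
      (ih (hP.mono (by simp)) fun i hi => h i (by simp [hi])) ?_
    simp only [Finset.disjoint_singleton_left, Finset.mem_image, not_exists, not_and]
    intro i hi hia
    have := hP (by simp [hi]) (by simp) hia
    exact ha (this ▸ hi)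

/-- A rational function without poles at infinity, all of whose residues vanish, is constant. -/
theorem eq_const [Infinite L] (hf : SimpleRat S f) (h0 : (0 : L) ∉ S)
    (hres : ∀ p ∈ S, HasRes p f 0) {w : L} (hw : w ∉ S) : f w = f 0 := by
  obtain ⟨N, h1, h2⟩ := hf
  have hroot : ∀ p ∈ S, N.eval p = 0 := by
    intro p hp
    obtain ⟨h, hr, hp0, he⟩ := hres p hp
    have hcof : ∀ᶠ w in cofinite, w ∉ S := by
      have : {w | ¬ w ∉ S}.Finite := by simp
      exact this
    have hreg : Reg p fun w => h w * ∏ q ∈ S.erase p, (1 - w / q) := by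
      refine hr.mul ?_
      have := Reg.polynomial (p := p) (∏ q ∈ S.erase p, (1 - C q⁻¹ * X))
      simpa only [eval_prod_poles] using this
    have := (Reg.polynomial (p := p) N).eq_of_eventually_eq hreg (by
      filter_upwards [he, hcof] with w hw hwS
      rw [← h2 w hwS, ← hw, ← Finset.mul_prod_erase S _ hp]; ring)
    rw [this, hp0, zero_mul]
  have h00 := h2 0 h0
  simp only [zero_div, sub_zero, Finset.prod_const_one, mul_one] at h00
  -- The degree is at most `S.card`, but there are `S.card + 1` roots: the points of `S`, where
  -- vanishing residues kill `N`, and `0`.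
  have key : N - C (f 0) * ∏ p ∈ S, (1 - C p⁻¹ * X) = 0 := by
    refine eq_zero_of_natDegree_lt_card_of_eval_eq_zero' _ (insert 0 S) ?_ ?_
    · intro p hp
      rw [eval_sub, eval_mul, eval_C, eval_prod_poles]
      rcases Finset.mem_insert.1 hp with rfl | hp
      · simp [h00]
      · have hp0 : p ≠ 0 := fun h => h0 (h ▸ hp)
        rw [hroot p hp, Finset.prod_eq_zero hp (by simp [hp0])]; ring
    · rw [Finset.card_insert_of_notMem h0, Nat.lt_succ_iff]
      exact (natDegree_sub_le_of_le h1
        ((natDegree_C_mul_le _ _).trans (natDegree_prod_poles_le S))).trans (max_self _).le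
  have hN := congrArg (eval w) key
  rw [eval_sub, eval_mul, eval_C, eval_prod_poles, eval_zero, ← h2 w hw, ← sub_mul] at hN
  refine sub_eq_zero.1 ((mul_eq_zero.1 hN).resolve_right ?_)
  exact Finset.prod_ne_zero_iff.2 fun p hp =>
    one_sub_div_ne_zero (fun h => h0 (h ▸ hp)) fun h => hw (h ▸ hp)

end SimpleRat

end Regular

open Finset

set_option linter.unusedSectionVars false

/-! ### The factor `(1 - t z) / (1 - z)`, its reflection and its residues. -/

section Factor

variable {L : Type*} [Field L] {t : L}

/-- The basic factor `(1 - t z) / (1 - z)`. -/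
def e (t z : L) : L := (1 - t * z) / (1 - z)

@[simp] theorem e_zero : e t 0 = 1 := by simp [e]

theorem e_inv_eq (z : L) : (e t z)⁻¹ = (1 - z) / (1 - t * z) := inv_div _ _

theorem e_ne_zero {z : L} (h : z ≠ 1) (h' : t * z ≠ 1) : e t z ≠ 0 :=
  div_ne_zero (sub_ne_zero.2 h'.symm) (sub_ne_zero.2 h.symm)

/-- The reflection `z ↦ 1 / (t z)` inverts the factor up to `t`; the powers of `t` in the
coefficients come from here. -/
theorem e_inv_mul (ht : t ≠ 0) {z : L} (hz : z ≠ 0) : e t (t * z)⁻¹ = t * (e t z)⁻¹ := by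
  have h1 : 1 - t * (t * z)⁻¹ = -(1 - z) / z := by field_simp; ring
  have h2 : 1 - (t * z)⁻¹ = -(1 - t * z) / (t * z) := by field_simp; ring
  rw [e_inv_eq, e, h1, h2]
  -- In this degenerate case both sides are `0` by the convention for division by zero.
  by_cases h : 1 - t * z = 0
  · simp [h]
  · field_simp

theorem Reg.e {p : L} {f : L → L} (hf : Reg p f) (h : f p ≠ 1) :
    Reg p fun w => SignSum.e t (f w) :=
  ((Reg.const 1).sub ((Reg.const t).mul hf)).div ((Reg.const 1).sub hf) (sub_ne_zero.2 h.symm)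

theorem Reg.e_inv {p : L} {f : L → L} (hf : Reg p f) (h : t * f p ≠ 1) :
    Reg p fun w => (SignSum.e t (f w))⁻¹ := by
  simp only [e_inv_eq]
  exact ((Reg.const 1).sub hf).div ((Reg.const 1).sub ((Reg.const t).mul hf))
    (sub_ne_zero.2 h.symm)

theorem Reg.mul_right {p : L} (a : L) : Reg p fun w => w * a := Reg.id.mul (Reg.const a)

theorem HasRes.e {p : L} (hp : p ≠ 0) {g : L → L} (hg : Reg p g) :
    HasRes p (fun w => g w * SignSum.e t (w * p⁻¹)) ((1 - t) * g p) := by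
  have := HasRes.pole hp (((Reg.const 1).sub ((Reg.const t).mul (Reg.mul_right p⁻¹))).mul hg)
  simp only [mul_inv_cancel₀ hp, mul_one] at this
  convert this using 2 with w
  rw [SignSum.e, div_eq_mul_inv w]; ring

theorem HasRes.e_inv (ht : t ≠ 0) {p : L} (hp : p ≠ 0) {g : L → L} (hg : Reg p g) :
    HasRes p (fun w => g w * (SignSum.e t (w * (t * p)⁻¹))⁻¹) ((1 - t⁻¹) * g p) := by
  have := HasRes.pole hp (((Reg.const 1).sub (Reg.mul_right (t * p)⁻¹)).mul hg)
  have h : p * (t * p)⁻¹ = t⁻¹ := by field_simp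
  simp only [h] at this
  convert this using 2 with w
  have h : t * (w * (t * p)⁻¹) = w / p := by field_simp
  rw [e_inv_eq, h]; ring

theorem SimpleRat.e {a : L} (ha : a ≠ 0) : SimpleRat {a} fun w => SignSum.e t (w * a⁻¹) := by
  convert SimpleRat.factor ha 1 (-(t * a⁻¹)) using 2 with w
  rw [SignSum.e, div_eq_mul_inv w]; ring

theorem SimpleRat.e_inv (ht : t ≠ 0) {a : L} (ha : a ≠ 0) :
    SimpleRat {(t * a)⁻¹} fun w => (SignSum.e t (w * a))⁻¹ := by
  convert SimpleRat.factor (inv_ne_zero (mul_ne_zero ht ha)) 1 (-a) using 2 with w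
  rw [e_inv_eq, div_inv_eq_mul]; ring

end Factor

/-! ### Products over pairs, in a form suited to adding one index. -/

section PairProd

variable {ι M : Type*} [LinearOrder ι] [CommMonoid M]

/-- The product of `f i j` over all pairs `i < j` of elements of `s`. -/
def pairProd (s : Finset ι) (f : ι → ι → M) : M :=
  ∏ i ∈ s, ∏ j ∈ s, if i < j then f i j else 1

theorem pairProd_insert {s : Finset ι} {a : ι} (ha : a ∉ s) {f : ι → ι → M}
    (hf : ∀ i j, f i j = f j i) :
    pairProd (insert a s) f = (∏ i ∈ s, f a i) * pairProd s f := by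
  simp only [pairProd, prod_insert ha, lt_irrefl, if_false, one_mul, prod_mul_distrib]
  rw [← mul_assoc, ← prod_mul_distrib]
  congr 1
  refine prod_congr rfl fun i hi => ?_
  have : i ≠ a := fun h => ha (h ▸ hi)
  rcases lt_or_gt_of_ne this with h | h
  · simp [h, h.not_gt, hf a i]
  · simp [h, h.not_gt]

theorem pairProd_congr {s : Finset ι} {f g : ι → ι → M}
    (h : ∀ i ∈ s, ∀ j ∈ s, f i j = g i j) : pairProd s f = pairProd s g :=
  prod_congr rfl fun i hi => prod_congr rfl fun j hj => by rw [h i hi j hj]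

theorem pairProd_univ [Fintype ι] [LocallyFiniteOrderTop ι] (f : ι → ι → M) :
    pairProd univ f = ∏ i, ∏ j ∈ Ioi i, f i j := by
  refine prod_congr rfl fun i _ => ?_
  rw [← prod_filter]
  congr 1
  ext; simp

end PairProd

/-! ### The two sums over arbitrary finite index sets, and the effect of adding an index. -/

section Sums

variable {L ι κ : Type*} [Field L] [LinearOrder ι] [LinearOrder κ]

/-- Invert the coordinates in `J`. -/
def flipX (J : Finset ι) (x : ι → L) (i : ι) : L := if i ∈ J then (x i)⁻¹ else x i

/-- Apply `y ↦ 1 / (t y)` to the coordinates outside of `I`. -/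
def flipU (t : L) (I : Finset κ) (u : κ → L) (k : κ) : L := if k ∈ I then u k else (t * u k)⁻¹

def xTerm (t : L) (s : Finset ι) (ψ : L → L) (z : ι → L) : L :=
  (∏ i ∈ s, e t (z i ^ 2) * ψ (z i)) * pairProd s fun i j => e t (z i * z j)

/-- The sum over all `x ↦ x ^ ±1` of `Φ(x) ∏ ψ(xᵢ)`. -/
def xSum (t : L) (s : Finset ι) (x : ι → L) (ψ : L → L) : L :=
  ∑ J ∈ s.powerset, xTerm t s ψ (flipX J x)

def rProd (t : L) (s : Finset ι) (x : ι → L) (w : L) : L :=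
  ∏ i ∈ s, e t (w * x i) * e t (w * (x i)⁻¹)

def uTerm (t : L) (k : Finset κ) (wt : κ → L) (z : κ → L) : L :=
  (∏ j ∈ k, wt j) * pairProd k fun i j => (e t (z i * z j))⁻¹

def uWt (t : L) (s : Finset ι) (x : ι → L) (u : κ → L) (I : Finset κ) (j : κ) : L :=
  if j ∈ I then rProd t s x (u j) else t ^ s.card

/-- The term of `uSum` belonging to the subset `I`. -/
def uCoeff (t : L) (s : Finset ι) (x : ι → L) (k : Finset κ) (u : κ → L) (I : Finset κ) : L :=
  uTerm t k (uWt t s x u I) (flipU t I u)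

/-- The sum over subsets `I` of `c_I ∏_{i ∈ I} R(uᵢ)`. -/
def uSum (t : L) (s : Finset ι) (x : ι → L) (k : Finset κ) (u : κ → L) : L :=
  ∑ I ∈ k.powerset, uCoeff t s x k u I

def uWeight (t : L) (k : Finset κ) (u : κ → L) (y : L) : L := ∏ j ∈ k, e t (u j * y⁻¹)

/-- `xSum` with one more parameter `w`. -/
def xFun (t : L) (s : Finset ι) (x : ι → L) (k : Finset κ) (u : κ → L) (w : L) : L :=
  xSum t s x fun y => uWeight t k u y * e t (w * y⁻¹)

/-- The summands are the contributions of a new index with parameter `w`, put inside or outside `I`.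
In the second, the factors at `1 / (t w)` have been reflected, whence `(t ^ k.card)⁻¹`; this makes
the dependence on `w` visibly regular at `0`. -/
def uBracket (t : L) (s : Finset ι) (x : ι → L) (k : Finset κ) (v : κ → L) (w : L) : L :=
  rProd t s x w * ∏ j ∈ k, (e t (w * v j))⁻¹ +
    t ^ s.card * (t ^ k.card)⁻¹ * ∏ j ∈ k, e t (w * (v j)⁻¹)

/-- `uSum` with one more parameter `w`. -/
def uFun (t : L) (s : Finset ι) (x : ι → L) (k : Finset κ) (u : κ → L) (w : L) : L :=
  ∑ I ∈ k.powerset, uCoeff t s x k u I * uBracket t s x k (flipU t I u) w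

variable {t : L} {s : Finset ι} {x : ι → L} {k : Finset κ} {u : κ → L}

theorem xTerm_mul (ψ φ : L → L) (z : ι → L) :
    xTerm t s (fun y => ψ y * φ y) z = xTerm t s ψ z * ∏ i ∈ s, φ (z i) := by
  simp only [xTerm, prod_mul_distrib]; ring

theorem xTerm_congr {ψ : L → L} {z z' : ι → L} (h : ∀ i ∈ s, z i = z' i) :
    xTerm t s ψ z = xTerm t s ψ z' := by
  unfold xTerm
  congr 1
  · exact prod_congr rfl fun i hi => by rw [h i hi]
  · exact pairProd_congr fun i hi j hj => by rw [h i hi, h j hj]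

theorem xTerm_insert {a : ι} (ha : a ∉ s) (ψ : L → L) (z : ι → L) :
    xTerm t (insert a s) ψ z =
      xTerm t s ψ z * (e t (z a ^ 2) * ψ (z a) * ∏ i ∈ s, e t (z a * z i)) := by
  unfold xTerm
  rw [prod_insert ha, pairProd_insert ha fun i j => by rw [mul_comm]]
  ring

theorem flipX_insert_of_ne {a i : ι} (J : Finset ι) (h : i ≠ a) :
    flipX (insert a J) x i = flipX J x i := by
  simp [flipX, h]

theorem flipU_insert_of_ne {a i : κ} (I : Finset κ) (h : i ≠ a) :
    flipU t (insert a I) u i = flipU t I u i := by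
  simp [flipU, h]

/-- The sum is symmetric under `x a ↦ (x a)⁻¹`; allowing either value for `y` treats both poles at
once. -/
theorem xSum_insert {a : ι} (ha : a ∉ s) (ψ : L → L) {y : L} (hy : y = x a ∨ y = (x a)⁻¹) :
    xSum t (insert a s) x ψ = ∑ J ∈ s.powerset, xTerm t s ψ (flipX J x) *
      (e t (y ^ 2) * ψ y * ∏ i ∈ s, e t (y * flipX J x i) +
        e t (y⁻¹ ^ 2) * ψ y⁻¹ * ∏ i ∈ s, e t (y⁻¹ * flipX J x i)) := by
  rw [xSum, sum_powerset_insert ha, ← sum_add_distrib]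
  refine sum_congr rfl fun J hJ => ?_
  have haJ : a ∉ J := fun h => ha (mem_powerset.1 hJ h)
  have hs : ∀ i ∈ s, flipX (insert a J) x i = flipX J x i :=
    fun i hi => flipX_insert_of_ne J fun h => ha (h ▸ hi)
  have h1 : flipX J x a = x a := by simp [flipX, haJ]
  have h2 : flipX (insert a J) x a = (x a)⁻¹ := by simp [flipX]
  rw [xTerm_insert ha, xTerm_insert ha, h1, h2, xTerm_congr hs,
    prod_congr rfl fun i hi => congrArg (fun z => e t ((x a)⁻¹ * z)) (hs i hi)]
  rcases hy with rfl | rfl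
  · ring
  · rw [inv_inv]; ring

theorem uTerm_insert {b : κ} (hb : b ∉ k) (wt z : κ → L) :
    uTerm t (insert b k) wt z = uTerm t k wt z * (wt b * ∏ j ∈ k, (e t (z b * z j))⁻¹) := by
  unfold uTerm
  rw [prod_insert hb, pairProd_insert hb fun i j => by rw [mul_comm]]
  ring

theorem uTerm_congr {wt wt' z z' : κ → L} (hw : ∀ i ∈ k, wt i = wt' i)
    (h : ∀ i ∈ k, z i = z' i) : uTerm t k wt z = uTerm t k wt' z' := by
  unfold uTerm
  congr 1
  · exact prod_congr rfl hw
  · exact pairProd_congr fun i hi j hj => by rw [h i hi, h j hj]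

theorem uCoeff_insert_of_notMem {b : κ} (hb : b ∉ k) {I : Finset κ} (hI : I ⊆ k) :
    uCoeff t s x (insert b k) u I = uCoeff t s x k u I *
      (t ^ s.card * ∏ j ∈ k, (e t ((t * u b)⁻¹ * flipU t I u j))⁻¹) := by
  have hbI : b ∉ I := fun h => hb (hI h)
  rw [uCoeff, uTerm_insert hb]
  simp [uCoeff, uWt, flipU, hbI]

theorem uCoeff_insert_of_mem {b : κ} (hb : b ∉ k) {I : Finset κ} :
    uCoeff t s x (insert b k) u (insert b I) = uCoeff t s x k u I *
      (rProd t s x (u b) * ∏ j ∈ k, (e t (u b * flipU t I u j))⁻¹) := by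
  have hne : ∀ i ∈ k, i ≠ b := fun i hi h => hb (h ▸ hi)
  have hs : ∀ i ∈ k, flipU t (insert b I) u i = flipU t I u i :=
    fun i hi => flipU_insert_of_ne I (hne i hi)
  rw [uCoeff, uTerm_insert hb]
  congr 1
  · exact uTerm_congr (fun i hi => by simp [uWt, hne i hi]) hs
  · congr 1
    · simp [uWt]
    · exact prod_congr rfl fun i hi => by rw [hs i hi]; simp [flipU]

theorem prod_e_inv_mul_inv (ht : t ≠ 0) {y : L} (hy : y ≠ 0) {v : κ → L}
    (hv : ∀ j ∈ k, v j ≠ 0) :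
    ∏ j ∈ k, (e t ((t * y)⁻¹ * v j))⁻¹ = (t ^ k.card)⁻¹ * ∏ j ∈ k, e t (y * (v j)⁻¹) := by
  rw [← inv_pow, ← prod_const, ← prod_mul_distrib]
  refine prod_congr rfl fun j hj => ?_
  have hj := hv j hj
  have : (t * y)⁻¹ * v j = (t * (y * (v j)⁻¹))⁻¹ := by field_simp
  rw [this, e_inv_mul ht (mul_ne_zero hy (inv_ne_zero hj)), mul_inv, inv_inv]

theorem flipU_ne_zero (ht : t ≠ 0) (hu : ∀ j, u j ≠ 0) (I : Finset κ) (j : κ) :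
    flipU t I u j ≠ 0 := by
  unfold flipU
  split_ifs
  · exact hu j
  · exact inv_ne_zero (mul_ne_zero ht (hu j))

theorem uSum_insert (ht : t ≠ 0) (hu : ∀ j, u j ≠ 0) {b : κ} (hb : b ∉ k) :
    uSum t s x (insert b k) u = uFun t s x k u (u b) := by
  rw [uSum, sum_powerset_insert hb, ← sum_add_distrib]
  refine sum_congr rfl fun I hI => ?_
  rw [uCoeff_insert_of_notMem hb (mem_powerset.1 hI), uCoeff_insert_of_mem hb,
    prod_e_inv_mul_inv ht (hu b) fun j _ => flipU_ne_zero ht hu I j, uBracket]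
  ring

theorem uWeight_insert {b : κ} (hb : b ∉ k) (y : L) :
    uWeight t (insert b k) u y = uWeight t k u y * e t (u b * y⁻¹) := by
  rw [uWeight, prod_insert hb, mul_comm, uWeight]

theorem xSum_uWeight_insert {b : κ} (hb : b ∉ k) :
    xSum t s x (uWeight t (insert b k) u) = xFun t s x k u (u b) := by
  unfold xFun
  congr 1
  ext y
  exact uWeight_insert hb y

theorem xFun_zero : xFun t s x k u 0 = xSum t s x (uWeight t k u) := by
  simp [xFun]

/-- At `w = 0` the bracket no longer depends on `I`. Its value is the factor `1 + t ^ m`, `m =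
s.card - k.card`, in the recursion of the shifted factorial. -/
theorem uFun_zero : uFun t s x k u 0 = (1 + t ^ s.card * (t ^ k.card)⁻¹) * uSum t s x k u := by
  simp [uFun, uBracket, uSum, rProd, mul_sum, mul_comm]

theorem rProd_insert {a : ι} (ha : a ∉ s) {y : L} (hy : y = x a ∨ y = (x a)⁻¹) (w : L) :
    rProd t (insert a s) x w = e t (w * y) * e t (w * y⁻¹) * rProd t s x w := by
  rw [rProd, prod_insert ha, rProd]
  rcases hy with rfl | rfl
  · rfl
  · rw [inv_inv]; ring

/-- The product does not depend on `J`, which lets it be pulled out of the residue of `xFun`. -/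
theorem prod_flipX_eq_rProd (J : Finset ι) (y : L) :
    (∏ i ∈ s, e t (y * (flipX J x i)⁻¹)) * ∏ i ∈ s, e t (y * flipX J x i) = rProd t s x y := by
  rw [← prod_mul_distrib, rProd]
  refine prod_congr rfl fun i _ => ?_
  unfold flipX
  split_ifs
  · rw [inv_inv]
  · ring

end Sums

/-! ### Genericity, and the location of the poles. -/

section Generic

variable {L ι κ : Type*} [Field L] [LinearOrder ι] [LinearOrder κ]

/-- The non-degeneracy conditions under which all the denominators involved are non-zero and all
the poles are distinct. -/
structure Generic (t : L) (x : ι → L) (u : κ → L) : Prop where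
  t_ne : t ≠ 0
  x_ne : ∀ i, x i ≠ 0
  x_inj : Function.Injective x
  xx : ∀ i j, x i * x j ≠ 1
  txx : ∀ i j, t * (x i * x j) ≠ 1
  tx : ∀ i j, i ≠ j → t * x i ≠ x j
  u_ne : ∀ j, u j ≠ 0
  u_inj : Function.Injective u
  tuu : ∀ j l, t * (u j * u l) ≠ 1
  ux : ∀ j i, u j ≠ x i
  ux' : ∀ j i, u j * x i ≠ 1
  tux : ∀ j i, t * u j ≠ x i
  tux' : ∀ j i, t * (u j * x i) ≠ 1

namespace Generic

variable {t : L} {s : Finset ι} {x : ι → L} {k : Finset κ} {u : κ → L}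

/-- The conditions are stable under `u j ↦ 1 / (t u j)`, so facts about the point `u b` transfer to
`1 / (t u b)`. -/
theorem flipU (h : Generic t x u) (I : Finset κ) : Generic t x (flipU t I u) := by
  have ht := h.t_ne
  have hun := h.u_ne
  have hxn := h.x_ne
  refine ⟨h.t_ne, h.x_ne, h.x_inj, h.xx, h.txx, h.tx, flipU_ne_zero h.t_ne h.u_ne I,
    fun j l hjl => ?_, fun j l hjl => ?_, fun j i hji => ?_, fun j i hji => ?_,
    fun j i hji => ?_, fun j i hji => ?_⟩ <;> unfold SignSum.flipU at *
  · have := hun j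
    have := hun l
    split_ifs at hjl
    · exact h.u_inj hjl
    · exact absurd (by rw [hjl]; field_simp) (h.tuu j l)
    · exact absurd (by rw [← hjl]; field_simp) (h.tuu j l)
    · exact h.u_inj (mul_left_cancel₀ ht (inv_injective hjl))
  · have h1 := hun j
    have h2 := hun l
    have h3 := h.tuu j l
    split_ifs at hjl with hj hl hl
    · exact h3 hjl
    · have : u j = u l := by field_simp at hjl; exact hjl
      exact hl (h.u_inj this ▸ hj)
    · have : u j = u l := by field_simp at hjl; exact hjl.symm
      exact hj (h.u_inj this ▸ hl)
    · apply h3; field_simp at hjl; linear_combination -hjl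
  · have := hun j
    have := hxn i
    split_ifs at hji
    · exact h.ux j i hji
    · exact h.tux' j i (by rw [← hji]; field_simp)
  · have := hun j
    have := hxn i
    split_ifs at hji
    · exact h.ux' j i hji
    · exact h.tux j i (by field_simp at hji; exact hji.symm)
  · have := hun j
    have := hxn i
    split_ifs at hji
    · exact h.tux j i hji
    · exact h.ux' j i (by rw [← hji]; field_simp)
  · have := hun j
    have := hxn i
    split_ifs at hji
    · exact h.tux' j i hji
    · exact h.ux j i (by field_simp at hji; exact hji.symm)

theorem flipX_ne_zero (h : Generic t x u) (J : Finset ι) (i : ι) : flipX J x i ≠ 0 := by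
  unfold flipX
  split_ifs
  · exact inv_ne_zero (h.x_ne i)
  · exact h.x_ne i

theorem flipX_injective (h : Generic t x u) (J : Finset ι) : Function.Injective (flipX J x) := by
  intro i j hij
  unfold flipX at hij
  have h1 := h.x_ne i
  have h2 := h.x_ne j
  split_ifs at hij
  · exact h.x_inj (inv_injective hij)
  · exact absurd (by rw [← hij]; field_simp) (h.xx i j)
  · exact absurd (by rw [hij]; field_simp) (h.xx i j)
  · exact h.x_inj hij

theorem eq_flipX_of {J : Finset ι} {i : ι} {P : L → Prop} (h1 : P (x i)) (h2 : P (x i)⁻¹) :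
    P (flipX J x i) := by
  unfold flipX
  split_ifs
  · exact h2
  · exact h1

theorem ne_inv (h : Generic t x u) (i j : ι) : x i ≠ (x j)⁻¹ := fun he =>
  h.xx i j (by rw [he, inv_mul_cancel₀ (h.x_ne j)])

theorem inv_mul_ne (h : Generic t x u) {i j : ι} (hij : i ≠ j) : (x i)⁻¹ * x j ≠ 1 := fun he =>
  hij (h.x_inj (by rw [← mul_one (x i), ← he, mul_inv_cancel_left₀ (h.x_ne i)]))

end Generic

/-- The possible poles in the parameter `w`. -/
def poles (t : L) [DecidableEq L] (s : Finset ι) (x : ι → L) (k : Finset κ) (u : κ → L) :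
    Finset L :=
  ((s.image x) ∪ (s.image fun i => (x i)⁻¹)) ∪ ((k.image u) ∪ (k.image fun j => (t * u j)⁻¹))

variable {t : L} {s : Finset ι} {x : ι → L} {k : Finset κ} {u : κ → L} [DecidableEq L]

theorem flipX_mem_poles {i : ι} (hi : i ∈ s) (J : Finset ι) : flipX J x i ∈ poles t s x k u := by
  unfold flipX poles
  have h1 := mem_image_of_mem x hi
  have h2 := mem_image_of_mem (fun i => (x i)⁻¹) hi
  split_ifs <;> simp only [mem_union] <;> tauto

theorem flipU_mem_poles {j : κ} (hj : j ∈ k) (I : Finset κ) :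
    flipU t I u j ∈ poles t s x k u := by
  unfold flipU poles
  have h1 := mem_image_of_mem u hj
  have h2 := mem_image_of_mem (fun j => (t * u j)⁻¹) hj
  split_ifs <;> simp only [mem_union] <;> tauto

theorem inv_mul_flipU_mem_poles (ht : t ≠ 0) {j : κ} (hj : j ∈ k) (I : Finset κ) :
    (t * flipU t I u j)⁻¹ ∈ poles t s x k u := by
  unfold flipU poles
  have h1 := mem_image_of_mem u hj
  have h2 := mem_image_of_mem (fun j => (t * u j)⁻¹) hj
  split_ifs
  · simp only [mem_union]; tauto
  · have : (t * (t * u j)⁻¹)⁻¹ = u j := by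
      rw [mul_inv, inv_inv, inv_mul_cancel_left₀ ht]
    rw [this]; simp only [mem_union]; tauto

theorem xFun_eq (w : L) : xFun t s x k u w = ∑ J ∈ s.powerset,
    xTerm t s (uWeight t k u) (flipX J x) * ∏ i ∈ s, e t (w * (flipX J x i)⁻¹) := by
  simp only [xFun, xSum, xTerm_mul]

theorem simpleRat_xFun (h : Generic t x u) : SimpleRat (poles t s x k u) (xFun t s x k u) := by
  have : xFun t s x k u = fun w => _ := funext xFun_eq
  rw [this]
  refine SimpleRat.sum _ fun J _ => SimpleRat.const_mul _ ?_
  refine (SimpleRat.prod s (P := flipX J x) (h.flipX_injective J).injOn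
    fun i _ => SimpleRat.e (h.flipX_ne_zero J i)).mono ?_
  intro p hp
  obtain ⟨i, hi, rfl⟩ := mem_image.1 hp
  exact flipX_mem_poles hi J

theorem simpleRat_rProd (h : Generic t x u) :
    SimpleRat ((s.image fun i => (x i)⁻¹) ∪ s.image x) (rProd t s x) := by
  have : rProd t s x = fun w =>
      (∏ i ∈ s, e t (w * ((x i)⁻¹)⁻¹)) * ∏ i ∈ s, e t (w * (x i)⁻¹) := by
    ext w
    simp only [rProd, prod_mul_distrib, inv_inv]
  rw [this]
  refine (SimpleRat.prod s (P := fun i => (x i)⁻¹) (inv_injective.comp h.x_inj).injOn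
    fun i _ => SimpleRat.e (inv_ne_zero (h.x_ne i))).mul
    (SimpleRat.prod s (P := x) h.x_inj.injOn fun i _ => SimpleRat.e (h.x_ne i)) ?_
  rw [Finset.disjoint_left]
  intro p hp hp'
  obtain ⟨i, hi, rfl⟩ := mem_image.1 hp
  obtain ⟨j, hj, hij⟩ := mem_image.1 hp'
  exact h.ne_inv _ _ hij

theorem simpleRat_uFun (h : Generic t x u) : SimpleRat (poles t s x k u) (uFun t s x k u) := by
  refine SimpleRat.sum _ fun I _ => SimpleRat.const_mul _ (SimpleRat.add ?_ ?_)
  · have hI := h.flipU I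
    refine ((simpleRat_rProd h).mul (SimpleRat.prod k (P := fun j => (t * flipU t I u j)⁻¹) ?_
      fun j _ => SimpleRat.e_inv h.t_ne (hI.u_ne j)) ?_).mono ?_
    · exact (inv_injective.comp ((mul_right_injective₀ h.t_ne).comp hI.u_inj)).injOn
    · rw [Finset.disjoint_left]
      intro p hp hp'
      obtain ⟨j, hj, rfl⟩ := mem_image.1 hp'
      have := hI.u_ne j
      have := h.t_ne
      rcases mem_union.1 hp with hp | hp
      · obtain ⟨i, hi, hij⟩ := mem_image.1 hp
        exact hI.tux j i (inv_injective hij).symm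
      · obtain ⟨i, hi, hij⟩ := mem_image.1 hp
        exact hI.tux' j i (by rw [hij]; field_simp)
    · intro p hp
      rcases mem_union.1 hp with hp | hp
      · unfold poles
        simp only [mem_union] at hp ⊢
        tauto
      · obtain ⟨j, hj, rfl⟩ := mem_image.1 hp
        exact inv_mul_flipU_mem_poles h.t_ne hj I
  · have hI := h.flipU I
    refine SimpleRat.const_mul _ ((SimpleRat.prod k (P := flipU t I u) hI.u_inj.injOn
      fun j _ => SimpleRat.e (hI.u_ne j)).mono ?_)
    intro p hp
    obtain ⟨j, hj, rfl⟩ := mem_image.1 hp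
    exact flipU_mem_poles hj I

theorem zero_notMem_poles (h : Generic t x u) : (0 : L) ∉ poles t s x k u := by
  have := h.t_ne
  simp [poles, h.x_ne, h.u_ne, this]

end Generic

/-! ### Residues of `xFun` and `uFun`. -/

section Residues

variable {L ι κ : Type*} [Field L] [LinearOrder ι] [LinearOrder κ]
variable {t : L} {s : Finset ι} {x : ι → L} {k : Finset κ} {u : κ → L}

/-- The conditions on a pole `y = x a` or `y = (x a)⁻¹`. -/
structure XPole (t : L) (s : Finset ι) (x : ι → L) (u : κ → L) (y : L) : Prop where
  ne : y ≠ 0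
  sq : y * y ≠ 1
  x_ne : ∀ i ∈ s, y ≠ x i
  mul_ne : ∀ i ∈ s, y * x i ≠ 1
  u_ne : ∀ j, y ≠ u j
  u_mul : ∀ j, y * u j ≠ 1
  tu_mul : ∀ j, t * (y * u j) ≠ 1

theorem Generic.xPole (h : Generic t x u) {a : ι} (ha : a ∉ s) {y : L}
    (hy : y = x a ∨ y = (x a)⁻¹) : XPole t s x u y := by
  have hs : ∀ i ∈ s, i ≠ a := fun i hi h => ha (h ▸ hi)
  have h0 := h.x_ne a
  have h1 := h.xx
  rcases hy with rfl | rfl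
  · exact ⟨h0, h1 a a, fun i hi he => hs i hi (h.x_inj he).symm, fun i _ => h1 a i,
      fun j he => h.ux j a he.symm, fun j he => h.ux' j a (by rw [mul_comm, he]),
      fun j he => h.tux' j a (by rw [mul_comm (u j), he])⟩
  · refine ⟨inv_ne_zero h0, fun he => h1 a a ?_, fun i _ he => h.ne_inv i a he.symm,
      fun i hi => h.inv_mul_ne (hs i hi).symm, fun j he => h.ux' j a ?_,
      fun j he => h.ux j a ?_, fun j he => h.tux j a ?_⟩
    · field_simp at he; rw [← pow_two, ← he]
    · rw [← he, inv_mul_cancel₀ h0]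
    · field_simp at he; exact he
    · field_simp at he; exact he

namespace XPole

variable {y : L}

theorem flipX_ne (h : XPole t s x u y) (hx : ∀ i, x i ≠ 0) (J : Finset ι) {i : ι} (hi : i ∈ s) :
    y * (flipX J x i)⁻¹ ≠ 1 := by
  intro he
  unfold flipX at he
  have := hx i
  split_ifs at he
  · rw [inv_inv] at he; exact h.mul_ne i hi he
  · field_simp at he; exact h.x_ne i hi he

theorem reg_rProd (h : XPole t s x u y) (hx : ∀ i, x i ≠ 0) : Reg y (rProd t s x) := by
  refine Reg.prod _ fun i hi => (Reg.e (Reg.mul_right _) (h.mul_ne i hi)).mul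
    (Reg.e (Reg.mul_right _) fun he => h.x_ne i hi ?_)
  have := hx i
  field_simp at he
  exact he

end XPole

/-- Only the terms in which the variable of index `a` takes the value `y` contain the singular
factor `e t (w * y⁻¹)`; the opposite choice gives `e t (w * y)`, regular because `y * y ≠ 1`. -/
theorem hasRes_xFun (h : Generic t x u) {a : ι} (ha : a ∉ s) {y : L}
    (hy : y = x a ∨ y = (x a)⁻¹) :
    HasRes y (xFun t (insert a s) x k u) ((1 - t) * (e t (y ^ 2) * uWeight t k u y *
      rProd t s x y) * xSum t s x (uWeight t k u)) := by
  have hp := h.xPole ha hy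
  have hF : xFun t (insert a s) x k u = fun w => ∑ J ∈ s.powerset,
      ((xTerm t s (uWeight t k u) (flipX J x) * (e t (y ^ 2) * uWeight t k u y *
          ∏ i ∈ s, e t (y * flipX J x i))) * (∏ i ∈ s, e t (w * (flipX J x i)⁻¹)) *
          e t (w * y⁻¹) +
        (xTerm t s (uWeight t k u) (flipX J x) * (e t (y⁻¹ ^ 2) * uWeight t k u y⁻¹ *
          ∏ i ∈ s, e t (y⁻¹ * flipX J x i))) * ((∏ i ∈ s, e t (w * (flipX J x i)⁻¹)) *
          e t (w * y))) := by
    ext w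
    rw [xFun, xSum_insert ha _ hy]
    refine sum_congr rfl fun J _ => ?_
    rw [xTerm_mul, inv_inv]
    ring
  have hreg : ∀ J, Reg y fun w => ∏ i ∈ s, e t (w * (flipX J x i)⁻¹) := fun J =>
    Reg.prod _ fun i hi => Reg.e (Reg.mul_right _) (hp.flipX_ne h.x_ne J hi)
  rw [hF]
  have key := fun J : Finset ι => (HasRes.e (t := t) hp.ne ((Reg.const
      (xTerm t s (uWeight t k u) (flipX J x) * (e t (y ^ 2) * uWeight t k u y *
        ∏ i ∈ s, e t (y * flipX J x i)))).mul (hreg J))).add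
    (HasRes.of_reg hp.ne ((Reg.const
      (xTerm t s (uWeight t k u) (flipX J x) * (e t (y⁻¹ ^ 2) * uWeight t k u y⁻¹ *
        ∏ i ∈ s, e t (y⁻¹ * flipX J x i)))).mul ((hreg J).mul
      (Reg.e (t := t) (Reg.mul_right y) hp.sq))))
  convert HasRes.sum s.powerset (fun J _ => key J) hp.ne using 1
  rw [xSum, mul_sum]
  refine sum_congr rfl fun J _ => ?_
  rw [← prod_flipX_eq_rProd J y]
  ring

/-- Index by index, removing `a` leaves the factor `e t (u j * y⁻¹)` whether or not `j ∈ I`: by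
cancellation in `rProd` if `j ∈ I`, by reflection otherwise. Hence the residue of `uFun` has the
same factor `uWeight t k u y` as that of `xFun`. -/
theorem uCoeff_mul_prod (h : Generic t x u) {a : ι} (ha : a ∉ s) {y : L}
    (hy : y = x a ∨ y = (x a)⁻¹) (I : Finset κ) :
    uCoeff t (insert a s) x k u I * ∏ j ∈ k, (e t (y * flipU t I u j))⁻¹ =
      uCoeff t s x k u I * uWeight t k u y := by
  have hp := h.xPole ha hy
  have hw : ∀ j, uWt t (insert a s) x u I j * (e t (y * flipU t I u j))⁻¹ =
      uWt t s x u I j * e t (u j * y⁻¹) := by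
    intro j
    unfold uWt flipU
    split_ifs
    · rw [rProd_insert ha hy, mul_comm y]
      have : e t (u j * y) ≠ 0 := by
        rw [mul_comm]; exact e_ne_zero (hp.u_mul j) (hp.tu_mul j)
      field_simp
    · have h1 : y * (t * u j)⁻¹ = (t * (u j * y⁻¹))⁻¹ := by
        have := hp.ne; field_simp
      rw [h1, e_inv_mul h.t_ne (mul_ne_zero (h.u_ne j) (inv_ne_zero hp.ne)),
        card_insert_of_notMem ha, mul_inv, inv_inv]
      have := h.t_ne
      field_simp
      ring
  rw [uCoeff, uCoeff, uTerm, uTerm, uWeight, mul_right_comm, ← prod_mul_distrib,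
    mul_right_comm, ← prod_mul_distrib]
  simp only [hw]

theorem hasRes_uFun (h : Generic t x u) {a : ι} (ha : a ∉ s) {y : L}
    (hy : y = x a ∨ y = (x a)⁻¹) :
    HasRes y (uFun t (insert a s) x k u) ((1 - t) * (e t (y ^ 2) * uWeight t k u y *
      rProd t s x y) * uSum t s x k u) := by
  have hp := h.xPole ha hy
  have hF : uFun t (insert a s) x k u = fun w => ∑ I ∈ k.powerset,
      (uCoeff t (insert a s) x k u I * (e t (w * y) * rProd t s x w *
        ∏ j ∈ k, (e t (w * flipU t I u j))⁻¹) * e t (w * y⁻¹) +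
      uCoeff t (insert a s) x k u I * (t ^ (insert a s).card * (t ^ k.card)⁻¹) *
        ∏ j ∈ k, e t (w * (flipU t I u j)⁻¹)) := by
    ext w
    rw [uFun]
    refine sum_congr rfl fun J _ => ?_
    rw [uBracket, rProd_insert ha hy]
    ring
  have h1 : ∀ I, Reg y fun w => ∏ j ∈ k, (e t (w * flipU t I u j))⁻¹ := fun I =>
    Reg.prod _ fun j _ => Reg.e_inv (Reg.mul_right _) (((h.flipU I).xPole ha hy).tu_mul j)
  have h2 : ∀ I, Reg y fun w => ∏ j ∈ k, e t (w * (flipU t I u j)⁻¹) := fun I =>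
    Reg.prod _ fun j _ => Reg.e (Reg.mul_right _) fun he => by
      have := (h.flipU I).u_ne j
      field_simp at he
      exact ((h.flipU I).xPole ha hy).u_ne j he
  rw [hF]
  have key := fun I : Finset κ => (HasRes.e (t := t) hp.ne ((Reg.const
      (uCoeff t (insert a s) x k u I)).mul (((Reg.e (t := t) (Reg.mul_right y) hp.sq).mul
        (hp.reg_rProd h.x_ne)).mul (h1 I)))).add
    (HasRes.of_reg hp.ne ((Reg.const (uCoeff t (insert a s) x k u I *
      (t ^ (insert a s).card * (t ^ k.card)⁻¹))).mul (h2 I)))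
  convert HasRes.sum k.powerset (fun I _ => key I) hp.ne using 1
  rw [uSum, mul_sum]
  refine sum_congr rfl fun I _ => ?_
  rw [pow_two y]
  linear_combination (-(1 - t) * e t (y * y) * rProd t s x y) * uCoeff_mul_prod h ha hy I

/-- The parameter `w` meets only the `x i` and their inverses in `xFun`, so genericity makes it
regular here. -/
theorem hasRes_xFun_flipU (h : Generic t x u) (I : Finset κ) (b : κ) :
    HasRes (flipU t I u b) (xFun t s x k u) 0 := by
  have hI := h.flipU I
  refine HasRes.of_reg (hI.u_ne b) (Reg.sum _ fun J _ => ?_)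
  simp only [xTerm_mul]
  refine (Reg.const _).mul (Reg.prod _ fun i _ => Reg.e (Reg.mul_right _) ?_)
  intro he
  unfold flipX at he
  have := h.x_ne i
  split_ifs at he
  · rw [inv_inv] at he; exact hI.ux' b i he
  · field_simp at he; exact hI.ux b i he

theorem reg_rProd (h : Generic t x u) (b : κ) : Reg (u b) (rProd t s x) := by
  refine Reg.prod _ fun i hi => (Reg.e (Reg.mul_right _) (h.ux' b i)).mul
    (Reg.e (Reg.mul_right _) fun he => h.ux b i ?_)
  have := h.x_ne i
  field_simp at he
  exact he

/-- The contributions of `y` and `1 / (t y)` to the residue at `y` cancel. -/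
theorem hasRes_pair (h : Generic t x u) {b : κ} (hb : b ∉ k) (c r : L) :
    HasRes (u b) (fun w =>
      c * (r * rProd t s x (u b) * ∏ j ∈ k, (e t (u b * u j))⁻¹) *
        uBracket t s x (insert b k) u w +
      c * (r * t ^ s.card * ∏ j ∈ k, (e t ((t * u b)⁻¹ * u j))⁻¹) *
        uBracket t s x (insert b k) (Function.update u b (t * u b)⁻¹) w) 0 := by
  have ht := h.t_ne
  have hub := h.u_ne b
  have hne : ∀ j ∈ k, j ≠ b := fun j hj he => hb (he ▸ hj)
  have hR := reg_rProd (s := s) h b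
  have h1 : Reg (u b) fun w => ∏ j ∈ k, (e t (w * u j))⁻¹ :=
    Reg.prod _ fun j _ => Reg.e_inv (Reg.mul_right _) (h.tuu b j)
  have h2 : Reg (u b) fun w => ∏ j ∈ k, e t (w * (u j)⁻¹) :=
    Reg.prod _ fun j hj => Reg.e (Reg.mul_right _) fun he => by
      have := h.u_ne j
      field_simp at he
      exact hne j hj (h.u_inj he).symm
  have h3 : Reg (u b) fun w => (e t (w * u b))⁻¹ :=
    Reg.e_inv (Reg.mul_right _) (h.tuu b b)
  have h4 : Reg (u b) fun w => e t (w * (t * u b)) :=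
    Reg.e (Reg.mul_right _) fun he => h.tuu b b (by rw [← he]; ring)
  have hupd : ∀ j ∈ k, Function.update u b (t * u b)⁻¹ j = u j := fun j hj => by
    simp [hne j hj]
  set A := c * (r * rProd t s x (u b) * ∏ j ∈ k, (e t (u b * u j))⁻¹) with hA
  set B := c * (r * t ^ s.card * ∏ j ∈ k, (e t ((t * u b)⁻¹ * u j))⁻¹) with hB
  set q := t ^ s.card * (t ^ (k.card + 1))⁻¹ with hq
  -- Of the four summands, only the second and the third are singular at `u b`, with residue factors
  -- `1 - t` and `1 - t⁻¹`; the former also carries `t⁻¹` from `q`, so they cancel.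
  have hF : (fun w => A * uBracket t s x (insert b k) u w +
      B * uBracket t s x (insert b k) (Function.update u b (t * u b)⁻¹) w) = fun w =>
      ((A * (rProd t s x w * ((e t (w * u b))⁻¹ * ∏ j ∈ k, (e t (w * u j))⁻¹)) +
        (A * q) * (∏ j ∈ k, e t (w * (u j)⁻¹)) * e t (w * (u b)⁻¹)) +
      (B * (rProd t s x w * ∏ j ∈ k, (e t (w * u j))⁻¹) * (e t (w * (t * u b)⁻¹))⁻¹ +
        (B * q) * (e t (w * (t * u b)) * ∏ j ∈ k, e t (w * (u j)⁻¹)))) := by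
    ext w
    unfold uBracket
    rw [prod_insert hb, prod_insert hb, prod_insert hb, prod_insert hb,
      card_insert_of_notMem hb, Function.update_self, inv_inv,
      prod_congr (f := fun j => (e t (w * Function.update u b (t * u b)⁻¹ j))⁻¹) rfl
        fun j hj => by rw [hupd j hj],
      prod_congr (f := fun j => e t (w * (Function.update u b (t * u b)⁻¹ j)⁻¹)) rfl
        fun j hj => by rw [hupd j hj]]
    ring
  rw [hF]
  convert ((HasRes.of_reg hub ((Reg.const A).mul (hR.mul (h3.mul h1)))).add
    (HasRes.e hub ((Reg.const (A * q)).mul h2))).add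
    ((HasRes.e_inv ht hub ((Reg.const B).mul (hR.mul h1))).add
    (HasRes.of_reg hub ((Reg.const (B * q)).mul (h4.mul h2)))) using 1
  rw [hA, hB, hq, prod_e_inv_mul_inv ht hub fun j _ => h.u_ne j]
  have : (1 - t) * t⁻¹ + (1 - t⁻¹) = 0 := by field_simp; ring
  rw [pow_succ, mul_inv]
  linear_combination -(c * r * rProd t s x (u b) * (∏ j ∈ k, (e t (u b * u j))⁻¹) *
    (t ^ s.card) * (t ^ k.card)⁻¹ * ∏ j ∈ k, e t (u b * (u j)⁻¹)) * this

/-- Each factor is inverted, up to `t`, by the reflection. This makes the pair of terms for `b`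
symmetric under `u b ↦ 1 / (t u b)`, so that one residue computation serves both poles. -/
theorem rProd_mul_rProd (h : Generic t x u) (b : κ) :
    rProd t s x (u b) * rProd t s x (t * u b)⁻¹ = t ^ s.card * t ^ s.card := by
  have hb := h.u_ne b
  rw [rProd, rProd, ← prod_mul_distrib, ← prod_const, ← prod_mul_distrib]
  refine prod_congr rfl fun i _ => ?_
  have hx := h.x_ne i
  have h1 : (t * u b)⁻¹ * x i = (t * (u b * (x i)⁻¹))⁻¹ := by field_simp
  have h2 : (t * u b)⁻¹ * (x i)⁻¹ = (t * (u b * x i))⁻¹ := by field_simp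
  have h3 : e t (u b * x i) ≠ 0 := e_ne_zero (h.ux' b i) (h.tux' b i)
  have h4 : e t (u b * (x i)⁻¹) ≠ 0 := by
    refine e_ne_zero (fun he => h.ux b i ?_) fun he => h.tux b i ?_
    · field_simp at he; exact he
    · field_simp at he; exact he
  rw [h1, h2, e_inv_mul h.t_ne (mul_ne_zero hb hx),
    e_inv_mul h.t_ne (mul_ne_zero hb (inv_ne_zero hx))]
  generalize e t (u b * x i) = α at h3 ⊢
  generalize e t (u b * (x i)⁻¹) = β at h4 ⊢
  field_simp

theorem rProd_ne_zero (h : Generic t x u) (b : κ) : rProd t s x (u b) ≠ 0 := by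
  intro h0
  have := rProd_mul_rProd (s := s) h b
  rw [h0, zero_mul] at this
  exact mul_ne_zero (pow_ne_zero _ h.t_ne) (pow_ne_zero _ h.t_ne) this.symm

theorem uBracket_congr {v v' : κ → L} (hv : ∀ j ∈ k, v j = v' j) (w : L) :
    uBracket t s x k v w = uBracket t s x k v' w := by
  unfold uBracket
  rw [prod_congr rfl fun j hj => by rw [hv j hj],
    prod_congr (f := fun j => e t (w * (v j)⁻¹)) rfl fun j hj => by rw [hv j hj]]

theorem hasRes_uFun_insert (h : Generic t x u) {b : κ} (hb : b ∉ k) {y : L}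
    (hy : y = u b ∨ y = (t * u b)⁻¹) : HasRes y (uFun t s x (insert b k) u) 0 := by
  have ht := h.t_ne
  have hub := h.u_ne b
  have hy0 : y ≠ 0 := by
    rcases hy with rfl | rfl
    · exact hub
    · exact inv_ne_zero (mul_ne_zero ht hub)
  have hne : ∀ j ∈ k, j ≠ b := fun j hj he => hb (he ▸ hj)
  have hF : uFun t s x (insert b k) u = fun w => ∑ I ∈ k.powerset,
      (uCoeff t s x k u I * (t ^ s.card * ∏ j ∈ k, (e t ((t * u b)⁻¹ * flipU t I u j))⁻¹) *
          uBracket t s x (insert b k) (flipU t I u) w +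
        uCoeff t s x k u I * (rProd t s x (u b) * ∏ j ∈ k, (e t (u b * flipU t I u j))⁻¹) *
          uBracket t s x (insert b k) (flipU t (insert b I) u) w) := by
    ext w
    rw [uFun, sum_powerset_insert hb, ← sum_add_distrib]
    refine sum_congr rfl fun I hI => ?_
    rw [uCoeff_insert_of_notMem hb (mem_powerset.1 hI), uCoeff_insert_of_mem hb]
  rw [hF, ← sum_const_zero (s := k.powerset)]
  refine HasRes.sum _ (fun I hI => ?_) hy0
  have hbI : b ∉ I := fun h => hb (mem_powerset.1 hI h)
  have e1 : flipU t I u b = (t * u b)⁻¹ := by simp [flipU, hbI]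
  have e2 : flipU t (insert b I) u b = u b := by simp [flipU]
  have hs : ∀ j ∈ k, flipU t (insert b I) u j = flipU t I u j :=
    fun j hj => flipU_insert_of_ne I (hne j hj)
  have hbr : ∀ {v v' : κ → L}, v b = v' b → (∀ j ∈ k, v j = v' j) → ∀ w,
      uBracket t s x (insert b k) v w = uBracket t s x (insert b k) v' w :=
    fun h1 h2 => uBracket_congr fun j hj => by
      rcases mem_insert.1 hj with rfl | hj
      · exact h1
      · exact h2 j hj
  rcases hy with rfl | rfl
  · convert hasRes_pair (s := s) (h.flipU (insert b I)) hb (uCoeff t s x k u I) 1 using 1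
    · exact e2.symm
    · ext w
      rw [add_comm, e2, hbr (v := Function.update _ b _) (v' := flipU t I u) (by simp [e1])
        fun j hj => by simp [hne j hj, hs j hj]]
      rw [prod_congr rfl fun j hj => by rw [← hs j hj],
        prod_congr (f := fun j => (e t ((t * u b)⁻¹ * flipU t I u j))⁻¹) rfl
        fun j hj => by rw [← hs j hj]]
      ring
  · have hR := rProd_mul_rProd (s := s) h b
    have hR0 := rProd_ne_zero (s := s) (h.flipU I) b
    rw [e1] at hR0
    -- Since `b ∉ I`, the flipped tuple has `1 / (t u b)` in place of `u b`, and the two terms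
    -- exchange roles; the scalar `r` restores their weights `t ^ s.card` and `rProd t s x (u b)`.
    convert hasRes_pair (s := s) (h.flipU I) hb (uCoeff t s x k u I)
      (t ^ s.card * (rProd t s x (t * u b)⁻¹)⁻¹) using 1
    · exact e1.symm
    · ext w
      have e3 : (t * (t * u b)⁻¹)⁻¹ = u b := by field_simp
      have e4 : rProd t s x (u b) = t ^ s.card * (rProd t s x (t * u b)⁻¹)⁻¹ * t ^ s.card := by
        rw [eq_comm, mul_right_comm, ← hR, mul_assoc, mul_inv_cancel₀ hR0, mul_one]
      rw [e1, e3, hbr (v := Function.update _ b _) (v' := flipU t (insert b I) u) (by simp [e2])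
        fun j hj => by simp [hne j hj, hs j hj], ← e4,
        mul_assoc (t ^ s.card), inv_mul_cancel₀ hR0, mul_one]

end Residues

/-! ### The induction proving the summation formula. -/

section Identity

variable {L ι κ : Type*} [Field L] [LinearOrder ι] [LinearOrder κ]
variable {t : L} {s : Finset ι} {x : ι → L} {k : Finset κ} {u : κ → L}

theorem xFun_sub_uFun_eq [Infinite L] [DecidableEq L] (h : Generic t x u) (q : L)
    (ih : ∀ a ∈ s, xSum t (s.erase a) x (uWeight t k u) = q * uSum t (s.erase a) x k u)
    {w : L} (hw : w ∉ poles t s x k u) :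
    xFun t s x k u w - q * uFun t s x k u w = xFun t s x k u 0 - q * uFun t s x k u 0 := by
  have hf : SimpleRat (poles t s x k u)
      fun w => xFun t s x k u w + -q * uFun t s x k u w :=
    (simpleRat_xFun h).add ((simpleRat_uFun h).const_mul (-q))
  have hX : ∀ a ∈ s, ∀ y, y = x a ∨ y = (x a)⁻¹ →
      HasRes y (fun w => xFun t s x k u w + -q * uFun t s x k u w) 0 := by
    intro a ha y hy
    have h1 := hasRes_xFun (k := k) h (notMem_erase a s) hy
    have h2 := hasRes_uFun (k := k) h (notMem_erase a s) hy
    rw [insert_erase ha] at h1 h2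
    convert h1.add (h2.mul_reg (Reg.const (-q))) using 1
    rw [ih a ha]; ring
  have hU : ∀ b ∈ k, ∀ y, y = u b ∨ y = (t * u b)⁻¹ →
      HasRes y (fun w => xFun t s x k u w + -q * uFun t s x k u w) 0 := by
    intro b hb y hy
    have h1 : HasRes y (xFun t s x k u) 0 := by
      rcases hy with rfl | rfl
      · simpa [flipU] using hasRes_xFun_flipU (s := s) (k := k) h {b} b
      · simpa [flipU] using hasRes_xFun_flipU (s := s) (k := k) h ∅ b
    have h2 := hasRes_uFun_insert (s := s) h (notMem_erase b k) hy
    rw [insert_erase hb] at h2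
    simpa using h1.add (h2.mul_reg (Reg.const (-q)))
  have := hf.eq_const (zero_notMem_poles h) (fun p hp => ?_) hw
  · linear_combination this
  · simp only [poles, mem_union, mem_image] at hp
    rcases hp with (⟨a, ha, rfl⟩ | ⟨a, ha, rfl⟩) | (⟨b, hb, rfl⟩ | ⟨b, hb, rfl⟩)
    · exact hX a ha _ (Or.inl rfl)
    · exact hX a ha _ (Or.inr rfl)
    · exact hU b hb _ (Or.inl rfl)
    · exact hU b hb _ (Or.inr rfl)

theorem flipX_mul_ne_one (h : Generic t x u) (J : Finset ι) (i j : ι) :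
    flipX J x i * flipX J x j ≠ 1 := by
  intro he
  have hi := h.x_ne i
  have hj := h.x_ne j
  unfold flipX at he
  split_ifs at he with h1 h2 h2
  · rw [← mul_inv, inv_eq_one] at he
    exact h.xx i j he
  · exact h.inv_mul_ne (fun hij : i = j => h2 (hij ▸ h1)) he
  · rw [mul_comm] at he
    exact h.inv_mul_ne (fun hij : j = i => h1 (hij ▸ h2)) he
  · exact h.xx i j he

theorem uSum_empty : uSum t s x ∅ u = 1 := by
  simp [uSum, uCoeff, uTerm, pairProd]

theorem uFun_empty (w : L) : uFun t s x ∅ u w = rProd t s x w + t ^ s.card := by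
  simp [uFun, uBracket, uCoeff, uTerm, pairProd]

theorem uWeight_empty : uWeight t ∅ u = fun _ => 1 := by
  ext; simp [uWeight]

theorem xSum_one_param (h : Generic (1 : L) x u) : xSum 1 s x (fun _ => 1) = 2 ^ s.card := by
  have he : ∀ z : L, z ≠ 1 → e 1 z = 1 := fun z hz => by
    rw [e, one_mul, div_self (sub_ne_zero.2 hz.symm)]
  have : ∀ J ∈ s.powerset, xTerm 1 s (fun _ => 1) (flipX J x) = 1 := by
    intro J _
    simp [xTerm, pairProd, pow_two, he _ (flipX_mul_ne_one h J _ _)]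
  rw [xSum, sum_congr rfl this]
  simp

/-- At this `w`, the terms with `x a` inverted contain `e t t⁻¹ = 0`. In the others, each factor in
`w` is the reflection of a factor of `Φ` involving `x a`, and each such pair contributes `t`. -/
theorem xFun_special (h : Generic t x u) {a : ι} (ha : a ∉ s) :
    xFun t (insert a s) x ∅ u (t * x a)⁻¹ = t ^ (s.card + 1) * xSum t s x (fun _ => 1) := by
  have ht := h.t_ne
  have hx := h.x_ne a
  rw [xFun, xSum_insert ha _ (Or.inl rfl), xSum, mul_sum]
  refine sum_congr rfl fun J _ => ?_
  have h0 : e t ((t * x a)⁻¹ * x a) = 0 := by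
    have : (t * x a)⁻¹ * x a = t⁻¹ := by field_simp
    rw [this, e, mul_inv_cancel₀ ht]; simp
  have h1 : e t ((t * x a)⁻¹ * (x a)⁻¹) = t * (e t (x a ^ 2))⁻¹ := by
    rw [← e_inv_mul ht (pow_ne_zero 2 hx)]
    congr 1
    field_simp
  have h2 : e t (x a ^ 2) ≠ 0 := by
    rw [pow_two]; exact e_ne_zero (h.xx a a) (h.txx a a)
  have h3 : (∏ i ∈ s, e t ((t * x a)⁻¹ * (flipX J x i)⁻¹)) *
      ∏ i ∈ s, e t (x a * flipX J x i) = t ^ s.card := by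
    rw [← prod_mul_distrib, ← prod_const]
    refine prod_congr rfl fun i hi => ?_
    have hia : a ≠ i := fun h => ha (h ▸ hi)
    have hz := h.flipX_ne_zero J i
    have hxi := h.x_ne i
    have h4 : (t * x a)⁻¹ * (flipX J x i)⁻¹ = (t * (x a * flipX J x i))⁻¹ := by field_simp
    have h5 : e t (x a * flipX J x i) ≠ 0 := by
      refine Generic.eq_flipX_of (P := fun z => e t (x a * z) ≠ 0)
        (e_ne_zero (h.xx a i) (h.txx a i)) (e_ne_zero (fun he => ?_) fun he => ?_)
      · field_simp at he
        exact hia (h.x_inj he)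
      · field_simp at he
        exact h.tx a i hia he
    rw [h4, e_inv_mul ht (mul_ne_zero hx hz), mul_assoc, inv_mul_cancel₀ h5, mul_one]
  rw [xTerm_mul, uWeight_empty, h1, inv_inv, h0]
  rw [pow_succ t, ← h3]
  field_simp
  ring

theorem xSum_one [Infinite L] (h : Generic t x u) (s : Finset ι) :
    xSum t s x (fun _ => 1) = ∏ m ∈ range s.card, (1 + t ^ (m + 1)) := by
  classical
  -- For `t = 1` the evaluation point `1 / (t x a)` used below is itself the possible pole `(x
  -- a)⁻¹`.
  by_cases ht1 : t = 1
  · subst ht1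
    rw [xSum_one_param h]
    simp [one_add_one_eq_two]
  obtain ⟨n, hn⟩ : ∃ n, s.card = n := ⟨_, rfl⟩
  induction n generalizing s with
  | zero =>
    rw [card_eq_zero] at hn
    subst hn
    simp [xSum, xTerm, pairProd]
  | succ n ih =>
    obtain ⟨a, s, ha, rfl, hs⟩ := card_eq_succ.1 hn
    have ht := h.t_ne
    have hxa := h.x_ne a
    set q : L := ∏ m ∈ range n, (1 + t ^ (m + 1)) with hq
    have hw : (t * x a)⁻¹ ∉ poles t (insert a s) x ∅ u := by
      simp only [poles, image_empty, union_empty, mem_union, mem_image, not_or, not_exists,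
        not_and]
      refine ⟨fun i _ he => h.txx a i ?_, fun i _ he => ?_⟩
      · rw [he]; field_simp
      · have he := inv_injective he
        by_cases hia : a = i
        · subst hia
          exact ht1 (mul_right_cancel₀ hxa (by rw [one_mul, ← he]))
        · exact h.tx a i hia he.symm
    have key := xFun_sub_uFun_eq (k := ∅) h q (fun b hb => by
      have hc : ((insert a s).erase b).card = n := by
        rw [card_erase_of_mem hb, hn, Nat.add_sub_cancel]
      rw [uWeight_empty, uSum_empty, ih _ hc, hc, mul_one]) hw
    have h0 : rProd t (insert a s) x (t * x a)⁻¹ = 0 := by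
      have : (t * x a)⁻¹ * x a = t⁻¹ := by field_simp
      rw [rProd_insert ha (Or.inl rfl), this, e, mul_inv_cancel₀ ht]; simp
    rw [xFun_special h ha, ih s hs, hs, ← hq, uFun_empty, h0, xFun_zero, uFun_zero, uSum_empty,
      uWeight_empty, hn, card_empty] at key
    rw [hn, prod_range_succ, ← hq]
    simp only [pow_zero, inv_one] at key
    linear_combination -key

theorem apply_natCast_of_succ {q : ℤ → L} (q0 : q 0 = 1) (hq : ∀ m : ℤ, 0 < m →
    q m = q (m - 1) * (1 + t ^ m)) (n : ℕ) : q n = ∏ m ∈ range n, (1 + t ^ (m + 1)) := by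
  induction n with
  | zero => simpa using q0
  | succ n ih =>
    rw [hq _ (by positivity), prod_range_succ, ← ih]
    rw [Nat.cast_succ, add_sub_cancel_right, ← Nat.cast_succ, zpow_natCast]

/-- The summation formula for generic elements of a field; `q m` is `(-t; t)_m`. -/
theorem xSum_uWeight_eq [Infinite L] (h : Generic t x u) {q : ℤ → L} (q0 : q 0 = 1)
    (k : Finset κ) (s : Finset ι)
    (hq : ∀ m : ℤ, 0 < m ∨ (s.card : ℤ) - k.card < m → q m = q (m - 1) * (1 + t ^ m)) :
    xSum t s x (uWeight t k u) = q (s.card - k.card) * uSum t s x k u := by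
  classical
  induction k using Finset.induction_on generalizing s with
  | empty =>
    rw [uWeight_empty, xSum_one h, uSum_empty, card_empty, Nat.cast_zero, sub_zero,
      apply_natCast_of_succ q0 fun m hm => hq m (Or.inl hm), mul_one]
  | insert b k hb ih =>
    have hcard : ((insert b k).card : ℤ) = k.card + 1 := by
      rw [card_insert_of_notMem hb]; push_cast; ring
    rw [hcard] at hq ⊢
    have hub := h.u_ne b
    have ht := h.t_ne
    have hw : u b ∉ poles t s x k u := by
      simp only [poles, mem_union, mem_image, not_or, not_exists, not_and]
      refine ⟨⟨fun i _ he => h.ux b i he.symm, fun i _ he => h.ux' b i ?_⟩,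
        fun j hj he => hb (h.u_inj he ▸ hj), fun j _ he => h.tuu b j ?_⟩
      · rw [← he, inv_mul_cancel₀ (h.x_ne i)]
      · have := h.u_ne j
        rw [← he]; field_simp
    -- Erasing a variable and adding a parameter shift the index `s.card - k.card` equally, so the
    -- ratio of residues is exactly the factor sought for `insert b k`.
    have key := xFun_sub_uFun_eq h (q (s.card - (k.card + 1))) (fun a ha => by
      have hc : ((s.erase a).card : ℤ) = s.card - 1 := by
        rw [card_erase_of_mem ha, Nat.cast_sub (card_pos.2 ⟨a, ha⟩), Nat.cast_one]
      rw [ih (s.erase a) fun m hm => hq m (by rw [hc] at hm; omega), hc]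
      congr 2
      ring) hw
    rw [xSum_uWeight_insert hb, uSum_insert ht h.u_ne hb]
    -- The value at `w = 0` vanishes: the induction hypothesis for the same `s` gives `q (s.card -
    -- k.card)`, which the recursion expresses through the previous value.
    rw [xFun_zero, uFun_zero, ih s fun m hm => hq m (by omega), hq (s.card - k.card) (by omega),
      zpow_sub₀ ht, zpow_natCast, zpow_natCast, div_eq_mul_inv] at key
    have e1 : (s.card : ℤ) - k.card - 1 = s.card - (k.card + 1) := by ring
    rw [e1] at key
    linear_combination key

end Identity

/-! ### Genericity of the indeterminates, and expansion of the symmetrizer. -/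

section RationalFunctions

open RationalIdentity

variable {K : Type*} [Field K] {n r : ℕ}

theorem algebraMap_mul_gen_mul_gen_ne_one (a : K) (i j : Fin n ⊕ Fin r) :
    algebraMap K (RatField K n r) a * (algebraMap (MvPolynomial (Fin n ⊕ Fin r) K) _
      (MvPolynomial.X i) * algebraMap (MvPolynomial (Fin n ⊕ Fin r) K) _ (MvPolynomial.X j)) ≠
        1 := by
  rw [IsScalarTower.algebraMap_apply K (MvPolynomial (Fin n ⊕ Fin r) K) (RatField K n r),
    ← map_mul, ← map_mul, ← map_one (algebraMap (MvPolynomial (Fin n ⊕ Fin r) K) (RatField K n r)),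
    (IsFractionRing.injective (MvPolynomial (Fin n ⊕ Fin r) K) (RatField K n r)).ne_iff]
  intro h
  simpa using congrArg MvPolynomial.constantCoeff h

theorem algebraMap_mul_gen_ne_gen (a : K) {i j : Fin n ⊕ Fin r} (hij : i ≠ j) :
    algebraMap K (RatField K n r) a * algebraMap (MvPolynomial (Fin n ⊕ Fin r) K) _
      (MvPolynomial.X i) ≠ algebraMap (MvPolynomial (Fin n ⊕ Fin r) K) _ (MvPolynomial.X j) := by
  rw [IsScalarTower.algebraMap_apply K (MvPolynomial (Fin n ⊕ Fin r) K) (RatField K n r),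
    ← map_mul,
    (IsFractionRing.injective (MvPolynomial (Fin n ⊕ Fin r) K) (RatField K n r)).ne_iff]
  intro h
  have := congrArg (MvPolynomial.coeff (Finsupp.single j 1)) h
  rw [MvPolynomial.algebraMap_eq, MvPolynomial.coeff_C_mul, MvPolynomial.coeff_X,
    MvPolynomial.coeff_X, if_neg] at this
  · simp at this
  · rw [Finsupp.single_left_inj one_ne_zero]
    exact hij

theorem gen_ne_zero (i : Fin n ⊕ Fin r) :
    algebraMap (MvPolynomial (Fin n ⊕ Fin r) K) (RatField K n r) (MvPolynomial.X i) ≠ 0 := by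
  rw [Ne, IsFractionRing.to_map_eq_zero_iff]
  exact MvPolynomial.X_ne_zero i

theorem generic_indeterminates {t : K} (ht : t ≠ 0) :
    Generic (algebraMap K (RatField K n r) t) (RationalIdentity.x : Fin n → _)
      (RationalIdentity.u : Fin r → _) := by
  have h1 : ∀ i j : Fin n ⊕ Fin r, _ := algebraMap_mul_gen_mul_gen_ne_one (1 : K)
  have h2 : ∀ i j : Fin n ⊕ Fin r, i ≠ j → _ :=
    fun i j => algebraMap_mul_gen_ne_gen (1 : K) (i := i) (j := j)
  simp only [map_one, one_mul] at h1 h2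
  exact
    { t_ne := by simpa using ht
      x_ne := fun i => gen_ne_zero _
      x_inj := fun i j h => by_contra fun hij => h2 _ _ (by simpa using hij) h
      xx := fun i j => h1 _ _
      txx := fun i j => algebraMap_mul_gen_mul_gen_ne_one t _ _
      tx := fun i j hij => algebraMap_mul_gen_ne_gen t (by simpa using hij)
      u_ne := fun j => gen_ne_zero _
      u_inj := fun i j h => by_contra fun hij => h2 _ _ (by simpa using hij) h
      tuu := fun i j => algebraMap_mul_gen_mul_gen_ne_one t _ _
      ux := fun j i => h2 _ _ (by simp)
      ux' := fun j i => h1 _ _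
      tux := fun j i => algebraMap_mul_gen_ne_gen t (by simp)
      tux' := fun j i => algebraMap_mul_gen_mul_gen_ne_one t _ _ }

theorem T_flipX (i : Fin n) {J : Finset (Fin n)} (hi : i ∉ J) :
    (fun j => T i (flipX J (RationalIdentity.x : Fin n → RatField K n r) j)) =
      flipX (insert i J) RationalIdentity.x := by
  ext j
  unfold flipX
  by_cases hj : j ∈ J
  · have hji : j ≠ i := fun h => hi (h ▸ hj)
    simp [hj, hji]
  · by_cases hji : j = i
    · subst hji; simp [hj]
    · simp [hj, hji]

/-- Expanding the product chooses, for each `i`, whether `T i` acts. The hypothesis `hE` says that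
`E` is built from its arguments and elements fixed by every `T i`, so the operators act on the
arguments alone. -/
theorem list_prod_one_add_T_apply {E : (Fin n → RatField K n r) → RatField K n r}
    (hE : ∀ i y, T i (E y) = E fun j => T i (y j)) {l : List (Fin n)} (hl : l.Nodup) :
    (l.map fun i => (1 + (T i).toLinearMap : Module.End K (RatField K n r))).prod
      (E RationalIdentity.x) = ∑ J ∈ l.toFinset.powerset, E (flipX J RationalIdentity.x) := by
  induction l with
  | nil => simp; rfl
  | cons i l ih =>
    rw [List.nodup_cons] at hl
    have hi : i ∉ l.toFinset := by simpa using hl.1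
    rw [List.map_cons, List.prod_cons, Module.End.mul_apply, ih hl.2, List.toFinset_cons,
      sum_powerset_insert hi, LinearMap.add_apply, Module.End.one_apply, map_sum]
    congr 1
    refine sum_congr rfl fun J hJ => ?_
    rw [← T_flipX i fun h => hi (mem_powerset.1 hJ h)]
    exact hE i _

theorem symmetrizer_apply {E : (Fin n → RatField K n r) → RatField K n r}
    (hE : ∀ i y, T i (E y) = E fun j => T i (y j)) :
    symmetrizer K n r (E RationalIdentity.x) =
      ∑ J : Finset (Fin n), E (flipX J RationalIdentity.x) := by
  rw [symmetrizer, List.ofFn_eq_map, list_prod_one_add_T_apply hE (List.nodup_finRange n),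
    List.toFinset_finRange, powerset_univ]

theorem T_xTerm (t : K) (i : Fin n) (y : Fin n → RatField K n r) :
    T i (xTerm (algebraMap K _ t) univ (uWeight (algebraMap K _ t) univ RationalIdentity.u) y) =
      xTerm (algebraMap K _ t) univ (uWeight (algebraMap K _ t) univ RationalIdentity.u)
        fun j => T i (y j) := by
  have he : ∀ z : RatField K n r,
      T i (e (algebraMap K _ t) z) = e (algebraMap K _ t) (T i z) := fun z => by
    simp [e]
  simp only [xTerm, uWeight, pairProd, map_mul, map_prod, he, map_pow, map_inv₀, T_u,
    apply_ite (T i), map_one]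

end RationalFunctions

/-! ### Translation between the stated expressions and the auxiliary sums. -/

section Specialization

variable {L : Type*} [Field L] {n r : ℕ}

theorem Phi_mul_prod_eq_xTerm (t : L) (y : Fin n → L) (u : Fin r → L) :
    RationalIdentity.Phi t y * ∏ k, ∏ i, (1 - t * u k / y i) / (1 - u k / y i) =
      xTerm t univ (uWeight t univ u) y := by
  rw [xTerm, pairProd_univ, RationalIdentity.Phi, prod_mul_distrib, Finset.prod_comm]
  simp only [e, uWeight, div_eq_mul_inv, mul_assoc]
  ring

theorem c_mul_prod_R_eq_uCoeff (t : L) (x : Fin n → L) (u : Fin r → L) (I : Finset (Fin r)) :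
    RationalIdentity.c n t u I * ∏ i ∈ I, RationalIdentity.R t x (u i) =
      uCoeff t univ x univ u I := by
  have hv : RationalIdentity.v t u I = flipU t I u := by
    ext i; simp [RationalIdentity.v, flipU]
  have hR : ∀ w, RationalIdentity.R t x w = rProd t univ x w := fun w => by
    simp only [RationalIdentity.R, rProd, e, div_eq_mul_inv, mul_assoc]
  rw [uCoeff, uTerm, pairProd_univ, RationalIdentity.c, hv]
  simp only [uWt, hR, e_inv_eq, prod_ite, prod_const, card_univ, Fintype.card_fin,
    filter_mem_eq_inter, univ_inter, ← mul_assoc]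
  have : #{j | j ∉ I} = r - #I := by
    rw [filter_not, filter_mem_eq_inter, univ_inter, card_sdiff_of_subset (subset_univ I),
      card_univ, Fintype.card_fin]
  rw [this, pow_mul]
  ring

/-- For `m ≤ 0` the factor `1 + t ^ m` occurs inverted in the value at `m - 1`, so it has to be
non-zero in order to cancel. -/
theorem qPochhammer_step {t : L} (ht : t ≠ 0) {m : ℤ}
    (h : m ≤ 0 → 1 + t ^ m ≠ 0) : RationalIdentity.qPochhammer (-t) t m =
      RationalIdentity.qPochhammer (-t) t (m - 1) * (1 + t ^ m) := by
  rcases m with (_ | k) | k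
  · have h := h le_rfl
    simp only [Int.ofNat_eq_natCast, Nat.cast_zero, zpow_zero, zero_sub] at h ⊢
    change (∏ j ∈ range 0, _) = (∏ j ∈ range (0 + 1), (1 - -t / t ^ (j + 1))⁻¹) * (1 + 1)
    have h1 : 1 - -t / t ^ (0 + 1) = 1 + 1 := by field_simp; ring
    rw [prod_range_succ, prod_range_zero, prod_range_zero, h1, one_mul, inv_mul_cancel₀ h]
  · have : Int.ofNat (k + 1) - 1 = Int.ofNat k := by simp
    rw [this]
    simp only [RationalIdentity.qPochhammer, prod_range_succ, Int.ofNat_eq_natCast, zpow_natCast]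
    ring
  · have h := h (Int.negSucc_lt_zero k).le
    have h1 : Int.negSucc k - 1 = Int.negSucc (k + 1) := by
      rw [Int.negSucc_eq, Int.negSucc_eq]; push_cast; ring
    rw [h1]
    have h2 : 1 - -t / t ^ (k + 1 + 1) = 1 + t ^ Int.negSucc k := by
      rw [zpow_negSucc]; field_simp; ring
    simp only [RationalIdentity.qPochhammer]
    rw [prod_range_succ _ (k + 1), h2, mul_assoc, inv_mul_cancel₀ h, mul_one]

end Specialization

end SignSum

theorem theorem6 {K : Type*} [Field K] (n r : ℕ) (t : K) (ht : t ≠ 0)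
    (ht' : ∀ k < r - n, t ^ k + 1 ≠ 0) :
    let F := RationalIdentity.RatField K n r
    let τ : F := algebraMap K F t
    let x : Fin n → F := RationalIdentity.x
    let u : Fin r → F := RationalIdentity.u
    RationalIdentity.symmetrizer K n r
        (RationalIdentity.Phi τ x *
          ∏ k, ∏ i, (1 - τ * u k / x i) / (1 - u k / x i)) =
      RationalIdentity.qPochhammer (-τ) τ ((n : ℤ) - (r : ℤ)) *
        ∑ I : Finset (Fin r),
          RationalIdentity.c n τ u I * ∏ i ∈ I, RationalIdentity.R τ x (u i) := by
  intro F τ x u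
  have hgen : SignSum.Generic τ x u := SignSum.generic_indeterminates ht
  rw [SignSum.Phi_mul_prod_eq_xTerm, SignSum.symmetrizer_apply (SignSum.T_xTerm t)]
  simp only [SignSum.c_mul_prod_R_eq_uCoeff]
  -- Without indeterminates the field may be finite, which the root-counting arguments exclude; the
  -- identity is then `1 = 1`.
  rcases isEmpty_or_nonempty (Fin n ⊕ Fin r) with hE | hE
  · obtain ⟨h1, h2⟩ := isEmpty_sum.1 hE
    have hn : n = 0 := (Fintype.card_fin n).symm.trans (Fintype.card_eq_zero_iff.2 h1)
    have hr : r = 0 := (Fintype.card_fin r).symm.trans (Fintype.card_eq_zero_iff.2 h2)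
    subst hn hr
    simp [SignSum.xTerm, SignSum.uCoeff, SignSum.uTerm, SignSum.pairProd,
      RationalIdentity.qPochhammer]
  · have : Infinite F := Infinite.of_injective _
      (IsFractionRing.injective (MvPolynomial (Fin n ⊕ Fin r) K) F)
    have key := SignSum.xSum_uWeight_eq hgen (q := RationalIdentity.qPochhammer (-τ) τ)
      (by simp [RationalIdentity.qPochhammer]) Finset.univ Finset.univ (fun m hm =>
        SignSum.qPochhammer_step hgen.t_ne fun hm0 h0 => by
          simp only [Finset.card_univ, Fintype.card_fin] at hm
          -- The recursion is used at non-positive `m` only for `n - r < m`, that is, `m = -k` with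
          -- `k < r - n`: the range covered by `ht'`.
          obtain ⟨k, rfl⟩ : ∃ k : ℕ, m = -k := ⟨m.natAbs, by omega⟩
          refine ht' k (by omega) ?_
          rw [zpow_neg, zpow_natCast] at h0
          have h1 : τ ^ k + 1 = 0 := by
            have := pow_ne_zero k hgen.t_ne
            rw [← mul_zero (τ ^ k), ← h0, mul_add, mul_one, mul_inv_cancel₀ this]
          apply (algebraMap K F).injective
          rw [map_add, map_pow, map_one, map_zero]
          exact h1)
    simpa only [SignSum.xSum, SignSum.uSum, Finset.powerset_univ, Finset.card_univ,
      Fintype.card_fin] using key
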